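/- Let $n\ge 3$ and consider the root system $D_n$ in $\mathbb{Q}^n$ with orthonormal basis $\varepsilon_{\bar n},\dots,\varepsilon_{\bar 1}$; write $\beta=(\beta_{\bar n},\dots,\beta_{\bar 1})$. The simple roots are $\varepsilon_{\overline{i+1}}-\varepsilon_{\bar i}$ $(1\le i<n)$ and $\varepsilon_{\bar 2}+\varepsilon_{\bar 1}$, and the positive roots are $\varepsilon_{\bar i}\pm\varepsilon_{\bar j}$ $(1\le j<i\le n)$. Let $\rho$ be the half sum of the positive roots, $W$ the Weyl group with length function $\ell$, and $P^+_{D_n}$ the set of dominant weights of $\mathfrak{so}_{2n}$ (half-integral ones included). For every weight $\beta$ put $$a_\beta=\sum_{\sigma\in W}(-1)^{\ell(\sigma)}x^{\sigma(\beta)},\qquad s_\beta=\frac{a_{\beta+\rho}}{a_\rho},$$ so that for dominant $\lambda$ the function $s_\lambda$ is the Weyl character of the irreducible module $V(\lambda)$, and $$Q^{D_n}_\beta=\sum_{(k_\alpha)\in\mathbb{N}^{R^+}}q^{\sum_\alpha k_\alpha}\,s_{\beta+\sum_\alpha k_\alpha\alpha},$$ a formal power series in $q$; here $R^+$ is the set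 of positive roots. For dominant $\lambda,\mu$ let $$K^{D_n}_{\lambda,\mu}(q)=\sum_{\sigma\in W}(-1)^{\ell(\sigma)}\mathcal{P}_q(\sigma(\lambda+\rho)-(\mu+\rho)),\qquad \prod_{\alpha\in R^+}\frac1{1-qx^\alpha}=\sum_\beta\mathcal{P}_q(\beta)x^\beta .$$ Use the same definitions for $D_{n-1}$, with basis $\varepsilon_{\overline{n-1}},\dots,\varepsilon_{\bar 1}$. For $\gamma,\lambda\in P^+_{D_{n-1}}$ and $r\ge 0$ let $d^\lambda_{\gamma,r}$ be the multiplicity of $V(\lambda)$ in the $D_{n-1}$-module $V(\gamma)\otimes V(r\varepsilon_{\overline{n-1}})$, that is $s_\gamma\,s_{r\varepsilon_{\overline{n-1}}}=\sum_\lambda d^\lambda_{\gamma,r}s_\lambda$, and let $(\gamma\otimes r)_{n-1}$ be the set of $\lambda$ with $d^\lambda_{\gamma,r}\ne0$. Then for every $\mu\in P^+_{D_n}$, with $\mu'=(\mu_{\overline{n-1}},\dots,\mu_{\bar 1})$, $$Q^{D_n}_\mu=\sum_{\gamma\in P^+_{D_{n-1}}}\ \sum_{R=0}^{\infty}\ \sum_{r+2m=R}q^R\sum_{\lambda\in(\gamma\otimes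 r)_{n-1}}d^\lambda_{\gamma,r}\,K^{D_{n-1}}_{\lambda,\mu'}(q)\,s_{(\mu_{\bar n}+R,\gamma)},$$ where $r,m\ge0$. The right-hand side converges as a sum of formal power series in $q$: for each power of $q$ only finitely many quadruples $(\gamma,r,m,\lambda)$ contribute. -/

import Mathlib

/-
The root system `D_n`, realised in `ℚⁿ`.  A vector `β : Fin n → ℚ` stands for
`(β_{n̄}, …, β_{1̄})`, so that position `0` is the coordinate on `ε_{n̄}` and the last position is
the coordinate on `ε_{1̄}`.  Removing the first coordinate (`Fin.tail`) passes from rank `n + 1` to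
rank `n`, and `Fin.cons a γ` is the vector `(a, γ)`.
-/

namespace TypeD

open scoped BigOperators

noncomputable section

/-- The basis vector `ε` in position `i`. -/
def eps {n : ℕ} (i : Fin n) : Fin n → ℚ := Pi.single i 1

/-- The simple roots of `D_n`: the differences `ε_i - ε_{i+1}` of consecutive basis vectors, and the
sum of the last two basis vectors. -/
def simpleRoots (n : ℕ) : Set (Fin n → ℚ) :=
  {α | ∃ i j : Fin n, (i : ℕ) + 1 = j ∧ α = eps i - eps j} ∪
  {α | ∃ i j : Fin n, (i : ℕ) + 1 = j ∧ (j : ℕ) + 1 = n ∧ α = eps i + eps j}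

/-- The positive roots of `D_n` are the `ε_i - ε_j` and `ε_i + ε_j` with `i < j` (in the order of
positions); the Boolean chooses the sign. -/
abbrev PosRoot (n : ℕ) : Type := {p : Fin n × Fin n // p.1 < p.2} × Bool

/-- The vector of a positive root. -/
def PosRoot.vec {n : ℕ} (α : PosRoot n) : Fin n → ℚ :=
  if α.2 then eps α.1.1.1 - eps α.1.1.2 else eps α.1.1.1 + eps α.1.1.2

/-- The half sum of the positive roots. -/
def rho (n : ℕ) : Fin n → ℚ := (1 / 2 : ℚ) • ∑ α : PosRoot n, α.vec

/-- Dominant weights: the vectors `λ = ∑ i, m_i Λ_i` with `m_i ∈ ℕ`, that is those whose pairing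
with every simple (co)root is a natural number.  (All roots of `D_n` have square length `2`, so roots
and coroots agree.)  For `n ≥ 2` these are the generalized partitions
`λ_{n̄} ≥ ⋯ ≥ λ_{2̄} ≥ |λ_{1̄}|`, all of whose parts are integers or all of whose parts are
half-odd-integers. -/
def IsDominant {n : ℕ} (v : Fin n → ℚ) : Prop :=
  ∀ α ∈ simpleRoots n, ∃ m : ℕ, v ⬝ᵥ α = m

/-- The cone of dominant weights `P⁺` of `D_n`. -/
abbrev Dom (n : ℕ) : Type := {v : Fin n → ℚ // IsDominant v}

/-! ### The Weyl group -/

/-- `g` is the reflection in a simple root. -/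
def IsSimpleReflection {n : ℕ} (g : (Fin n → ℚ) ≃ₗ[ℚ] (Fin n → ℚ)) : Prop :=
  ∃ α ∈ simpleRoots n, ∀ v, g v = v - (v ⬝ᵥ α) • α

/-- The Weyl group, generated by the simple reflections. -/
def weylGroup (n : ℕ) : Subgroup ((Fin n → ℚ) ≃ₗ[ℚ] (Fin n → ℚ)) :=
  Subgroup.closure {g | IsSimpleReflection g}

/-- The length of a Weyl group element with respect to the simple reflections. -/
def length {n : ℕ} (w : weylGroup n) : ℕ :=
  sInf {k | ∃ l : List ((Fin n → ℚ) ≃ₗ[ℚ] (Fin n → ℚ)),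
    l.length = k ∧ (∀ g ∈ l, IsSimpleReflection g) ∧ l.prod = (w : (Fin n → ℚ) ≃ₗ[ℚ] (Fin n → ℚ))}

/-- The vectors `± ε_i`. -/
def signedBasis (n : ℕ) : Set (Fin n → ℚ) := Set.range eps ∪ Set.range fun i => -eps i

lemma eps_dot {n : ℕ} (k : Fin n) (v : Fin n → ℚ) : eps k ⬝ᵥ v = v k := by
  simp [eps]

lemma simpleReflection_mem {n : ℕ} {g : (Fin n → ℚ) ≃ₗ[ℚ] (Fin n → ℚ)}
    (hg : IsSimpleReflection g) {v : Fin n → ℚ} (hv : v ∈ signedBasis n) :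
    g v ∈ signedBasis n := by
  have key : ∀ k : Fin n, g (eps k) ∈ signedBasis n := by
    intro k
    obtain ⟨α, hα, h⟩ := hg
    rw [h, eps_dot]
    rcases hα with ⟨i, j, hij, rfl⟩ | ⟨i, j, hij, -, rfl⟩
    · have hne : i ≠ j := by rintro rfl; omega
      by_cases hi : k = i
      · subst hi
        left; exact ⟨j, by simp [eps, hne]⟩
      · by_cases hj : k = j
        · subst hj
          left; exact ⟨i, by simp [eps, hi]⟩
        · left; exact ⟨k, by simp [eps, hi, hj]⟩
    · have hne : i ≠ j := by rintro rfl; omega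
      by_cases hi : k = i
      · subst hi
        right; exact ⟨j, by simp [eps, hne]⟩
      · by_cases hj : k = j
        · subst hj
          right; exact ⟨i, by simp [eps, hi]⟩
        · left; exact ⟨k, by simp [eps, hi, hj]⟩
  have hneg : ∀ x ∈ signedBasis n, -x ∈ signedBasis n := by
    rintro x (⟨k, rfl⟩ | ⟨k, rfl⟩)
    · right; exact ⟨k, rfl⟩
    · left; exact ⟨k, by simp⟩
  rcases hv with ⟨k, rfl⟩ | ⟨k, rfl⟩
  · exact key k
  · simp only [map_neg]
    exact hneg _ (key k)

lemma isSimpleReflection_inv {n : ℕ} {g : (Fin n → ℚ) ≃ₗ[ℚ] (Fin n → ℚ)}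
    (hg : IsSimpleReflection g) : IsSimpleReflection g⁻¹ := by
  obtain ⟨α, hα, h⟩ := hg
  refine ⟨α, hα, fun v => ?_⟩
  have h2 : α ⬝ᵥ α = 2 := by
    rcases hα with ⟨i, j, hij, rfl⟩ | ⟨i, j, hij, -, rfl⟩
    · have hne : i ≠ j := by rintro rfl; omega
      rw [sub_dotProduct, eps_dot, eps_dot]
      simp [eps, hne, hne.symm]; norm_num
    · have hne : i ≠ j := by rintro rfl; omega
      rw [add_dotProduct, eps_dot, eps_dot]
      simp [eps, hne, hne.symm]; norm_num
  apply g.injective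
  have : g (g⁻¹ v) = v := LinearEquiv.apply_symm_apply g v
  rw [this, h, sub_dotProduct, smul_dotProduct, h2, smul_eq_mul]
  module

lemma weylGroup_mem {n : ℕ} {g : (Fin n → ℚ) ≃ₗ[ℚ] (Fin n → ℚ)} (hg : g ∈ weylGroup n)
    {v : Fin n → ℚ} (hv : v ∈ signedBasis n) : g v ∈ signedBasis n := by
  induction hg using Subgroup.closure_induction'' generalizing v with
  | mem x hx => exact simpleReflection_mem hx hv
  | inv_mem x hx => exact simpleReflection_mem (isSimpleReflection_inv hx) hv
  | one => exact hv
  | mul x y _ _ hx hy => exact hx (hy hv)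

instance finite_weylGroup (n : ℕ) : Finite (weylGroup n) := by
  have hfin : Finite (signedBasis n) :=
    ((Set.finite_range _).union (Set.finite_range _)).to_subtype
  refine Finite.of_injective
    (fun (w : weylGroup n) (i : Fin n) =>
      (⟨w.1 (eps i), weylGroup_mem w.2 (Or.inl ⟨i, rfl⟩)⟩ : signedBasis n)) ?_
  intro w w' h
  apply Subtype.ext
  apply LinearEquiv.toLinearMap_injective
  refine (Pi.basisFun ℚ (Fin n)).ext fun i => ?_
  have := congrArg Subtype.val (congrFun h i)
  simpa [eps, Pi.basisFun_apply] using this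

instance fintype_weylGroup (n : ℕ) : Fintype (weylGroup n) := Fintype.ofFinite _

/-! ### Schur functions (Weyl characters) -/

/-- The group ring of `ℚⁿ` over `ℤ`, which contains the group ring of the weight lattice.  The
formal exponential `x^β` is `AddMonoidAlgebra.single β 1`. -/
abbrev GroupRing (n : ℕ) : Type := AddMonoidAlgebra ℤ (Fin n → ℚ)

/-- The field in which the quotients `a_{β+ρ} / a_ρ` are formed. -/
abbrev CharField (n : ℕ) : Type := FractionRing (GroupRing n)

/-- The alternating sum `a_β = ∑_{σ ∈ W} (-1)^{ℓ(σ)} x^{σ(β)}`. -/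
def alt {n : ℕ} (β : Fin n → ℚ) : GroupRing n :=
  ∑ σ : weylGroup n, AddMonoidAlgebra.single (σ.1 β) ((-1 : ℤ) ^ length σ)

/-- The Schur function `s_β = a_{β+ρ} / a_ρ`, for an arbitrary (not necessarily dominant) `β`.
For dominant `λ` it is the Weyl character of the irreducible module `V(λ)`. -/
def schur {n : ℕ} (β : Fin n → ℚ) : CharField n :=
  algebraMap (GroupRing n) (CharField n) (alt (β + rho n)) /
    algebraMap (GroupRing n) (CharField n) (alt (rho n))

/-- The multiplicity of `V(λ)` in `V(γ) ⊗ V(δ)`, computed from characters: the coefficient of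
`s_λ` when the product of the characters of `V(γ)` and `V(δ)` is written as a finite integral
combination of irreducible characters.  The expansion exists and is unique, since the `s_λ` with `λ`
dominant form a `ℤ`-basis of the ring of Weyl group invariants of the group ring of the weight
lattice. -/
def tensorMult {n : ℕ} (γ : Dom n) (δ : Fin n → ℚ) (lam : Dom n) : ℤ :=
  open Classical in
  if h : ∃ c : Dom n →₀ ℤ,
      schur γ.1 * schur δ = c.sum fun ν m => (m : CharField n) * schur ν.1 then
    h.choose lam
  else 0

/-- The one-row weight `r ε` (`ε` the first basis vector), the highest weight of the `r`-th Cartan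
power of the vector representation.  For rank at least `3` the vector `ε` is a fundamental weight. -/
def rowWeight (n r : ℕ) : Fin n → ℚ := fun i => if (i : ℕ) = 0 then (r : ℚ) else 0

/-- The Pieri multiplicity `d^λ_{γ,r}`. -/
def pieriMult {n : ℕ} (γ : Dom n) (r : ℕ) (lam : Dom n) : ℤ :=
  tensorMult γ (rowWeight n r) lam

/-- The set `γ ⊗ r` of the dominant `λ` with `d^λ_{γ,r} ≠ 0`. -/
def tensorSet {n : ℕ} (γ : Dom n) (r : ℕ) : Set (Dom n) := {lam | pieriMult γ r lam ≠ 0}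

/-! ### Kostka–Foulkes polynomials and the functions `Q_β` -/

lemma rho_dot_aux {n : ℕ} (k : PosRoot n → ℕ) (β : Fin n → ℚ)
    (h : ∑ α, (k α : ℚ) • α.vec = β) (α : PosRoot n) :
    (k α : ℚ) ≤ ∑ i : Fin n, ((n : ℚ) - 1 - (i : ℕ)) * β i := by
  have ht : ∀ a : PosRoot n, (1 : ℚ) ≤ ∑ i : Fin n, ((n : ℚ) - 1 - (i : ℕ)) * a.vec i := by
    rintro ⟨⟨⟨i, j⟩, hij⟩, b⟩
    have hij' : (i : ℕ) < (j : ℕ) := hij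
    have hc : ((i : ℕ) : ℚ) + 1 ≤ ((j : ℕ) : ℚ) := by exact_mod_cast hij'
    have hn : ((j : ℕ) : ℚ) + 1 ≤ (n : ℚ) := by exact_mod_cast j.2
    cases b
    · simp [PosRoot.vec, eps, mul_add, Finset.sum_add_distrib, Pi.single_apply]
      linarith
    · simp [PosRoot.vec, eps, mul_sub, Finset.sum_sub_distrib, Pi.single_apply]
      linarith
  have e : ∑ i : Fin n, ((n : ℚ) - 1 - (i : ℕ)) * β i
      = ∑ a : PosRoot n, (k a : ℚ) * ∑ i : Fin n, ((n : ℚ) - 1 - (i : ℕ)) * a.vec i := by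
    rw [← h]
    simp only [Finset.sum_apply, Pi.smul_apply, smul_eq_mul, Finset.mul_sum]
    rw [Finset.sum_comm]
    exact Finset.sum_congr rfl fun a _ => Finset.sum_congr rfl fun i _ => by ring
  rw [e]
  calc (k α : ℚ) ≤ (k α : ℚ) * ∑ i : Fin n, ((n : ℚ) - 1 - (i : ℕ)) * α.vec i :=
        le_mul_of_one_le_right (Nat.cast_nonneg _) (ht α)
    _ ≤ _ := Finset.single_le_sum
        (f := fun a : PosRoot n => (k a : ℚ) * ∑ i : Fin n, ((n : ℚ) - 1 - (i : ℕ)) * a.vec i)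
        (fun a _ => mul_nonneg (Nat.cast_nonneg _) (zero_le_one.trans (ht a))) (Finset.mem_univ α)

/-- There are finitely many ways to write a vector as a sum of positive roots. -/
lemma finite_partitions {n : ℕ} (β : Fin n → ℚ) :
    {k : PosRoot n → ℕ | ∑ α, (k α : ℚ) • α.vec = β}.Finite := by
  refine (Set.finite_Iic (fun _ : PosRoot n =>
    ⌊∑ i : Fin n, ((n : ℚ) - 1 - (i : ℕ)) * β i⌋₊)).subset ?_
  intro k hk α
  exact Nat.le_floor (rho_dot_aux k β hk α)

/-- The `q`-analogue `𝒫_q(β)` of Kostant's partition function: the coefficient of `x^β` in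
`∏_{α > 0} (1 - q x^α)⁻¹`, that is the sum of `q^{∑ k_α}` over all families of natural numbers
`k_α` with `∑ k_α α = β`. -/
def partitionFn {n : ℕ} (β : Fin n → ℚ) : Polynomial ℤ :=
  ∑ k ∈ (finite_partitions β).toFinset, Polynomial.X ^ (∑ α, k α)

/-- The Kostka–Foulkes polynomial
`K_{λ,μ}(q) = ∑_{σ ∈ W} (-1)^{ℓ(σ)} 𝒫_q(σ(λ+ρ) - (μ+ρ))`. -/
def kostkaFoulkes {n : ℕ} (lam mu : Fin n → ℚ) : Polynomial ℤ :=
  ∑ σ : weylGroup n, (-1) ^ length σ * partitionFn (σ.1 (lam + rho n) - (mu + rho n))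

/-- `Q_β = (∏_{α > 0} (1 - q R_α)⁻¹) s_β`, where `R_α` raises the index by `α`, as a formal power
series in `q`: the coefficient of `q^N` is the sum of the `s_{β + ∑ k_α α}` over all families of
natural numbers `k_α` with `∑ k_α = N`. -/
def hallLittlewoodQ {n : ℕ} (β : Fin n → ℚ) : PowerSeries (CharField n) :=
  PowerSeries.mk fun N =>
    ∑ k ∈ Finset.piAntidiag (Finset.univ : Finset (PosRoot n)) N,
      schur (β + ∑ α, (k α : ℚ) • α.vec)

/-! ### The recurrence -/

/-- A family of formal power series has the (unconditional) sum `S`: for each power of `q`, only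
finitely many members contribute, and the contributions add up to the coefficient in `S`. -/
def HasFormalSum {ι F : Type*} [Field F] (f : ι → PowerSeries F) (S : PowerSeries F) : Prop :=
  ∀ N : ℕ, {i | PowerSeries.coeff N (f i) ≠ 0}.Finite ∧
    ∑ᶠ i, PowerSeries.coeff N (f i) = PowerSeries.coeff N S

/-- The summation range: a dominant weight `γ`, natural numbers `R`, `r`, `m` with `r + 2m = R`, and
`λ ∈ γ ⊗ r`. -/
structure MorrisIndex (n : ℕ) where
  gam : Dom n
  R : ℕ
  r : ℕ
  m : ℕ
  hR : r + 2 * m = R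
  lam : Dom n
  hlam : lam ∈ tensorSet gam r

/-- The summand `q^R d^λ_{γ,r} K_{λ,μ'}(q) s_{(μ_{n̄} + R, γ)}`, with the Pieri multiplicity and the
Kostka–Foulkes polynomial taken in rank `n` and the Schur function in rank `n + 1`. -/
def morrisTerm {n : ℕ} (mu : Fin (n + 1) → ℚ) (i : MorrisIndex n) :
    PowerSeries (CharField (n + 1)) :=
  PowerSeries.X ^ i.R *
    (((kostkaFoulkes i.lam.1 (Fin.tail mu)).map (Int.castRingHom (CharField (n + 1))) :
      Polynomial (CharField (n + 1))) : PowerSeries (CharField (n + 1))) *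
    PowerSeries.C ((pieriMult i.gam i.r i.lam : CharField (n + 1)) *
      schur (Fin.cons (mu 0 + i.R) i.gam.1 : Fin (n + 1) → ℚ))

end

end TypeD

/-!
The recurrence is the branching of the raising-operator definition of `Q_μ` along the first
coordinate.  The positive roots of `D_{n+1}` are the vectors `(1, ±ε_i)` and the positive roots of
`D_n` (`prod_posRoot_succ`), so the coefficient of `q^N` in `Q_μ` is the sum over `R + M = N` of the
values of the functional `x^δ ↦ s_{(μ₀ + R, δ)}` on `h_R · p_M` (`coeff_hallLittlewoodQ`).  Here `h_R`
is the character of the `R`-th symmetric power of the vector representation of `D_n` and `p_M`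
is the coefficient of `q^M` in `x^{μ'} ∏_{α > 0} (1 - q x^α)⁻¹`.

Since `ρ` restricts from rank `n + 1` to rank `n`, this functional is antisymmetric for the dot action
of the Weyl group of `D_n` (`isDotAntisymmetric_schurCons`).  An antisymmetric functional sees an
element `f` of the group ring of the weight lattice only through its straightened form, in which
`x^γ`, for `γ` dominant, has the coefficient `∑_w (-1)^{ℓ(w)} [x^{w · γ}] f`
(`IsDotAntisymmetric.apply_eq_straighten`).  Multiplication by a Weyl group invariant preserves
antisymmetry.  The straightening coefficients of `p_M` are the coefficients of `q^M` in the
Kostka–Foulkes polynomials `K_{λ,μ'}` (`coeff_kostkaFoulkes`).  The straightening coefficients of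
`s_{rε} x^λ` are tensor product multiplicities by Brauer's formula (`tensorMult_eq`), which rests on
the linear independence of the Weyl characters; they are symmetric in `λ` and `γ` because `s_{rε}` is
invariant under negation of weights (`pieriMult_symm`).

The link is the decomposition `h_R = ∑_{r + 2m = R} s_{rε}`, that is `s_{rε} = h_r - h_{r-2}`
(`rowChar_mul_alt_rho`).  It is proved with generating functions, by multiplying
`∑_r q^r a_{rε + ρ}`, an alternating sum of geometric series, by the invariant polynomial
`∏_i (1 - q x^{ε_i})(1 - q x^{-ε_i})`: almost all terms of the expansion are fixed by a reflection,
and only `(1 - q²) a_ρ` remains.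
-/

namespace TypeD

open scoped BigOperators

noncomputable section

/-! ### Simple reflections, signs and signed permutations -/

lemma mem_simpleRoots_sub {n : ℕ} {i j : Fin n} (h : (i : ℕ) + 1 = j) :
    eps i - eps j ∈ simpleRoots n := Or.inl ⟨i, j, h, rfl⟩

lemma mem_simpleRoots_add {n : ℕ} {i j : Fin n} (h : (i : ℕ) + 1 = j) (hj : (j : ℕ) + 1 = n) :
    eps i + eps j ∈ simpleRoots n := Or.inr ⟨i, j, h, hj, rfl⟩

lemma dot_eps_sub {n : ℕ} (v : Fin n → ℚ) (i j : Fin n) :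
    v ⬝ᵥ (eps i - eps j) = v i - v j := by
  rw [dotProduct_comm, sub_dotProduct, eps_dot, eps_dot]

lemma dot_eps_add {n : ℕ} (v : Fin n → ℚ) (i j : Fin n) :
    v ⬝ᵥ (eps i + eps j) = v i + v j := by
  rw [dotProduct_comm, add_dotProduct, eps_dot, eps_dot]

lemma simpleRoot_dot_self {n : ℕ} {α : Fin n → ℚ} (hα : α ∈ simpleRoots n) : α ⬝ᵥ α = 2 := by
  rcases hα with ⟨i, j, hij, rfl⟩ | ⟨i, j, hij, -, rfl⟩
  · have hne : i ≠ j := by rintro rfl; omega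
    rw [dot_eps_sub]; simp [eps, hne, hne.symm]; norm_num
  · have hne : i ≠ j := by rintro rfl; omega
    rw [dot_eps_add]; simp [eps, hne, hne.symm]; norm_num

/-- The reflection in a simple root, as an element of the Weyl group. -/
def simpleRefl {n : ℕ} (α : Fin n → ℚ) (hα : α ∈ simpleRoots n) : weylGroup n :=
  ⟨LinearEquiv.ofInvolutive
    { toFun := fun v => v - (v ⬝ᵥ α) • α
      map_add' := fun v w => by rw [add_dotProduct]; module
      map_smul' := fun c v => by rw [smul_dotProduct, RingHom.id_apply, smul_eq_mul]; module }
    (fun v => by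
      change (v - (v ⬝ᵥ α) • α) - ((v - (v ⬝ᵥ α) • α) ⬝ᵥ α) • α = v
      rw [sub_dotProduct, smul_dotProduct, simpleRoot_dot_self hα, smul_eq_mul]
      module),
    Subgroup.subset_closure ⟨α, hα, fun _ => rfl⟩⟩

lemma simpleRefl_apply {n : ℕ} {α : Fin n → ℚ} (hα : α ∈ simpleRoots n) (v : Fin n → ℚ) :
    (simpleRefl α hα).1 v = v - (v ⬝ᵥ α) • α := rfl

/-- Weyl group elements are products of simple reflections. -/
lemma exists_word {n : ℕ} (w : weylGroup n) :
    ∃ l : List ((Fin n → ℚ) ≃ₗ[ℚ] (Fin n → ℚ)),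
      (∀ g ∈ l, IsSimpleReflection g) ∧ l.prod = w.1 := by
  have hw : w.1 ∈ (Subgroup.closure {g | IsSimpleReflection (n := n) g}).toSubmonoid := w.2
  rw [Subgroup.closure_toSubmonoid] at hw
  obtain ⟨l, hl, hw⟩ := Submonoid.exists_list_of_mem_closure hw
  refine ⟨l, fun g hg => ?_, hw⟩
  rcases hl g hg with h | h
  · exact h
  · simpa using isSimpleReflection_inv (Set.mem_inv.1 h)

lemma det_of_isSimpleReflection {n : ℕ} {g : (Fin n → ℚ) ≃ₗ[ℚ] (Fin n → ℚ)}
    (hg : IsSimpleReflection g) : LinearMap.det (g : (Fin n → ℚ) →ₗ[ℚ] (Fin n → ℚ)) = -1 := by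
  obtain ⟨α, hα, h⟩ := hg
  have : (g : (Fin n → ℚ) →ₗ[ℚ] (Fin n → ℚ)) =
      Matrix.toLin' (1 + Matrix.replicateCol Unit (-α) * Matrix.replicateRow Unit α) := by
    apply LinearMap.ext
    intro v
    rw [Matrix.toLin'_apply, Matrix.add_mulVec, Matrix.one_mulVec, ← Matrix.vecMulVec_eq,
      LinearEquiv.coe_coe, h]
    ext i
    simp only [Pi.sub_apply, Pi.add_apply, Pi.smul_apply, smul_eq_mul, Matrix.mulVec,
      Matrix.vecMulVec_apply, Pi.neg_apply, dotProduct, sub_eq_add_neg, Finset.sum_mul,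
      ← Finset.sum_neg_distrib]
    exact congrArg _ (Finset.sum_congr rfl fun j _ => by ring)
  rw [this, LinearMap.det_toLin', Matrix.det_one_add_replicateCol_mul_replicateRow,
    dotProduct_neg, simpleRoot_dot_self hα]
  norm_num

/-- The sign `(-1)^{ℓ(w)}`. -/
def weylSign {n : ℕ} (w : weylGroup n) : ℤ := (-1) ^ length w

/-- The sign is the determinant, which makes it multiplicative. -/
lemma weylSign_eq_det {n : ℕ} (w : weylGroup n) :
    (weylSign w : ℚ) = LinearMap.det ((w : (Fin n → ℚ) ≃ₗ[ℚ] (Fin n → ℚ)) :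
      (Fin n → ℚ) →ₗ[ℚ] (Fin n → ℚ)) := by
  have hne : {k | ∃ l : List ((Fin n → ℚ) ≃ₗ[ℚ] (Fin n → ℚ)), l.length = k ∧
      (∀ g ∈ l, IsSimpleReflection g) ∧ l.prod = (w : (Fin n → ℚ) ≃ₗ[ℚ] (Fin n → ℚ))}.Nonempty := by
    obtain ⟨l, hl, hw⟩ := exists_word w
    exact ⟨_, l, rfl, hl, hw⟩
  obtain ⟨l, hlen, hl, hw⟩ := Nat.sInf_mem hne
  have key : ∀ l : List ((Fin n → ℚ) ≃ₗ[ℚ] (Fin n → ℚ)), (∀ g ∈ l, IsSimpleReflection g) →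
      LinearMap.det (l.prod : (Fin n → ℚ) →ₗ[ℚ] (Fin n → ℚ)) = (-1) ^ l.length := by
    intro l
    induction l with
    | nil => intro _; simp
    | cons g l ih =>
      intro h
      have h1 := det_of_isSimpleReflection (h g (by simp))
      have h2 := ih fun g' hg' => h g' (by simp [hg'])
      have : (((g :: l).prod : (Fin n → ℚ) ≃ₗ[ℚ] (Fin n → ℚ)) : (Fin n → ℚ) →ₗ[ℚ] (Fin n → ℚ)) =
        (g : (Fin n → ℚ) →ₗ[ℚ] (Fin n → ℚ)) * (l.prod : (Fin n → ℚ) ≃ₗ[ℚ] (Fin n → ℚ)) := by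
        rw [List.prod_cons]; rfl
      rw [this, map_mul, h1, h2, List.length_cons, pow_succ, mul_comm]
  rw [← hw, key l hl, hlen]
  simp [weylSign, length]

lemma weylSign_mul {n : ℕ} (v w : weylGroup n) :
    weylSign (v * w) = weylSign v * weylSign w := by
  have : (weylSign (v * w) : ℚ) = weylSign v * weylSign w := by
    rw [weylSign_eq_det, weylSign_eq_det, weylSign_eq_det, ← map_mul]; rfl
  exact_mod_cast this

lemma weylSign_one {n : ℕ} : weylSign (1 : weylGroup n) = 1 := by
  have : (weylSign (1 : weylGroup n) : ℚ) = 1 := by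
    rw [weylSign_eq_det]; exact LinearMap.det_id
  exact_mod_cast this

lemma weylSign_mul_self {n : ℕ} (w : weylGroup n) : weylSign w * weylSign w = 1 := by
  rw [weylSign, ← mul_pow]; simp

lemma weylSign_inv {n : ℕ} (w : weylGroup n) : weylSign w⁻¹ = weylSign w := by
  have h : weylSign w⁻¹ * weylSign w = 1 := by rw [← weylSign_mul, inv_mul_cancel, weylSign_one]
  have := congrArg (· * weylSign w) h
  simpa [mul_assoc, weylSign_mul_self] using this

lemma weylSign_simpleRefl {n : ℕ} {α : Fin n → ℚ} (hα : α ∈ simpleRoots n) :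
    weylSign (simpleRefl α hα) = -1 := by
  have : (weylSign (simpleRefl α hα) : ℚ) = -1 := by
    rw [weylSign_eq_det]
    exact det_of_isSimpleReflection ⟨α, hα, simpleRefl_apply hα⟩
  exact_mod_cast this

lemma coe_mul_apply {n : ℕ} (v w : weylGroup n) (x : Fin n → ℚ) :
    (v * w).1 x = v.1 (w.1 x) := rfl

lemma coe_inv_apply_apply {n : ℕ} (w : weylGroup n) (x : Fin n → ℚ) :
    (w⁻¹).1 (w.1 x) = x := by
  rw [← coe_mul_apply, inv_mul_cancel]; rfl

lemma coe_apply_inv_apply {n : ℕ} (w : weylGroup n) (x : Fin n → ℚ) :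
    w.1 ((w⁻¹).1 x) = x := by
  rw [← coe_mul_apply, mul_inv_cancel]; rfl

/-- Induction over the Weyl group along products of simple reflections. -/
lemma weylGroup_induction {n : ℕ} {p : weylGroup n → Prop} (one : p 1)
    (mul : ∀ (α : Fin n → ℚ) (hα : α ∈ simpleRoots n) (w : weylGroup n), p w →
      p (simpleRefl α hα * w)) (w : weylGroup n) : p w := by
  obtain ⟨l, hl, hw⟩ := exists_word w
  have key : ∀ l : List ((Fin n → ℚ) ≃ₗ[ℚ] (Fin n → ℚ)),
      (∀ g ∈ l, IsSimpleReflection g) →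
      ∀ w : weylGroup n, l.prod = w.1 → p w := by
    intro l
    induction l with
    | nil =>
      intro _ w hw
      have : w = 1 := Subtype.ext hw.symm
      rwa [this]
    | cons g l ih =>
      intro h w hw
      obtain ⟨α, hα, hgα⟩ := h g (by simp)
      have hg' : g = (simpleRefl α hα).1 := by
        ext v : 1
        rw [hgα, simpleRefl_apply]
      have hw' : w = simpleRefl α hα * ((simpleRefl α hα)⁻¹ * w) := by group
      rw [hw']
      refine mul α hα _ (ih (fun x hx => h x (by simp [hx])) _ ?_)
      rw [Subgroup.coe_mul, ← hw, List.prod_cons, Subgroup.coe_inv, ← hg', inv_mul_cancel_left]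
  exact key l hl w hw

/-- Weyl group elements are signed permutations with an even number of sign changes. -/
lemma exists_signedPerm {n : ℕ} (w : weylGroup n) :
    ∃ (π : Equiv.Perm (Fin n)) (s : Fin n → ℚ), (∀ i, s i = 1 ∨ s i = -1) ∧ ∏ i, s i = 1 ∧
      ∀ v i, w.1 v i = s i * v (π i) := by
  induction w using weylGroup_induction with
  | one => exact ⟨1, fun _ => 1, by simp, by simp, fun v i => by simp⟩
  | mul α hα w ih =>
    have hs : ∃ (π : Equiv.Perm (Fin n)) (s : Fin n → ℚ), (∀ i, s i = 1 ∨ s i = -1) ∧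
        ∏ i, s i = 1 ∧ ∀ v i, (simpleRefl α hα).1 v i = s i * v (π i) := by
      simp only [simpleRefl_apply]
      rcases hα with ⟨i, j, hij, rfl⟩ | ⟨i, j, hij, -, rfl⟩
      · have hne : i ≠ j := by rintro rfl; omega
        refine ⟨Equiv.swap i j, fun _ => 1, by simp, by simp, fun v k => ?_⟩
        rw [dot_eps_sub]
        by_cases hi : k = i
        · subst hi; simp [eps, hne]
        · by_cases hj : k = j
          · subst hj; simp [eps, hne.symm]
          · simp [eps, hi, hj, Equiv.swap_apply_of_ne_of_ne]
      · have hne : i ≠ j := by rintro rfl; omega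
        refine ⟨Equiv.swap i j, fun k => (if k = i then -1 else 1) * (if k = j then -1 else 1),
          fun k => ?_, ?_, fun v k => ?_⟩
        · dsimp only; split_ifs <;> simp
        · rw [Finset.prod_mul_distrib]; simp
        · rw [dot_eps_add]
          by_cases hi : k = i
          · subst hi; simp [eps, hne]
          · by_cases hj : k = j
            · subst hj; simp [eps, hne.symm]
            · simp [eps, hi, hj, Equiv.swap_apply_of_ne_of_ne]
    obtain ⟨π, s, h1, h2, h3⟩ := hs
    obtain ⟨π', s', h1', h2', h3'⟩ := ih
    refine ⟨π.trans π', fun i => s i * s' (π i), fun i => ?_, ?_, fun v i => ?_⟩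
    · rcases h1 i with h | h <;> rcases h1' (π i) with h' | h' <;> simp [h, h']
    · rw [Finset.prod_mul_distrib, h2, Equiv.prod_comp π s', h2', one_mul]
    · rw [coe_mul_apply, h3, h3', Equiv.trans_apply, mul_assoc]

/-! ### The half sum of positive roots -/

lemma rho_apply {n : ℕ} (i : Fin n) : rho n i = (n : ℚ) - 1 - (i : ℕ) := by
  have h2 : ∀ p : {p : Fin n × Fin n // p.1 < p.2},
      (PosRoot.vec (p, true) + PosRoot.vec (p, false)) i = 2 * (eps p.1.1 i) := by
    intro p; simp [PosRoot.vec]; ring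
  have h1 : rho n i = ∑ p : {p : Fin n × Fin n // p.1 < p.2}, eps p.1.1 i := by
    rw [rho, Fintype.sum_prod_type, Pi.smul_apply, Finset.sum_apply]
    simp only [Fintype.sum_bool, h2, ← Finset.mul_sum]
    simp
  rw [h1, ← Finset.sum_subtype (Finset.univ.filter fun p : Fin n × Fin n => p.1 < p.2)
    (by simp) (fun p : Fin n × Fin n => eps p.1 i), Finset.sum_filter, Fintype.sum_prod_type,
    Finset.sum_eq_single i]
  · have hi : (i : ℕ) + 1 ≤ n := i.2
    simp only [eps, Pi.single_eq_same]
    rw [← Finset.sum_filter, Finset.sum_const, Finset.filter_lt_eq_Ioi, Fin.card_Ioi, Nat.sub_sub,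
      nsmul_eq_mul, mul_one, Nat.cast_sub (by omega)]
    push_cast; ring
  · intro k _ hk
    exact Finset.sum_eq_zero fun j _ => by simp [eps, hk.symm]
  · simp

lemma rho_dot_simpleRoot {n : ℕ} {α : Fin n → ℚ} (hα : α ∈ simpleRoots n) :
    rho n ⬝ᵥ α = 1 := by
  rcases hα with ⟨i, j, hij, rfl⟩ | ⟨i, j, hij, hj, rfl⟩
  · rw [dot_eps_sub, rho_apply, rho_apply, ← hij]; push_cast; ring
  · rw [dot_eps_add, rho_apply, rho_apply]
    have h1 : ((i : ℕ) : ℚ) + 1 = (j : ℕ) := by exact_mod_cast hij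
    have h2 : ((j : ℕ) : ℚ) + 1 = n := by exact_mod_cast hj
    linarith

/-! ### The weight lattice and dominant representatives of orbits -/

/-- The weight lattice of `D_n`: the vectors with integral pairing with all simple roots. -/
def weightLattice (n : ℕ) : AddSubgroup (Fin n → ℚ) where
  carrier := {v | ∀ α ∈ simpleRoots n, ∃ m : ℤ, v ⬝ᵥ α = m}
  zero_mem' := fun α _ => ⟨0, by simp⟩
  add_mem' := fun {v w} hv hw α hα => by
    obtain ⟨a, ha⟩ := hv α hα
    obtain ⟨b, hb⟩ := hw α hα
    exact ⟨a + b, by rw [add_dotProduct, ha, hb]; push_cast; rfl⟩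
  neg_mem' := fun {v} hv α hα => by
    obtain ⟨a, ha⟩ := hv α hα
    exact ⟨-a, by rw [neg_dotProduct, ha]; push_cast; rfl⟩

lemma mem_weightLattice_of_int {n : ℕ} {v : Fin n → ℚ} (h : ∀ i, ∃ m : ℤ, v i = m) :
    v ∈ weightLattice n := by
  rintro α (⟨i, j, -, rfl⟩ | ⟨i, j, -, -, rfl⟩)
  · obtain ⟨a, ha⟩ := h i
    obtain ⟨b, hb⟩ := h j
    exact ⟨a - b, by rw [dot_eps_sub, ha, hb]; push_cast; rfl⟩
  · obtain ⟨a, ha⟩ := h i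
    obtain ⟨b, hb⟩ := h j
    exact ⟨a + b, by rw [dot_eps_add, ha, hb]; push_cast; rfl⟩

lemma eps_mem_weightLattice {n : ℕ} (i : Fin n) : eps i ∈ weightLattice n :=
  mem_weightLattice_of_int fun j => ⟨if j = i then 1 else 0, by simp [eps, Pi.single_apply]⟩

lemma simpleRoot_mem_weightLattice {n : ℕ} {α : Fin n → ℚ} (hα : α ∈ simpleRoots n) :
    α ∈ weightLattice n := by
  rcases hα with ⟨i, j, -, rfl⟩ | ⟨i, j, -, -, rfl⟩
  · exact sub_mem (eps_mem_weightLattice i) (eps_mem_weightLattice j)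
  · exact add_mem (eps_mem_weightLattice i) (eps_mem_weightLattice j)

lemma posRoot_mem_weightLattice {n : ℕ} (α : PosRoot n) : α.vec ∈ weightLattice n := by
  unfold PosRoot.vec
  split_ifs
  · exact sub_mem (eps_mem_weightLattice _) (eps_mem_weightLattice _)
  · exact add_mem (eps_mem_weightLattice _) (eps_mem_weightLattice _)

lemma natCast_smul_mem_weightLattice {n : ℕ} (k : ℕ) {v : Fin n → ℚ} (hv : v ∈ weightLattice n) :
    (k : ℚ) • v ∈ weightLattice n := by
  rw [Nat.cast_smul_eq_nsmul]; exact nsmul_mem hv k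

lemma IsDominant.mem_weightLattice {n : ℕ} {v : Fin n → ℚ} (hv : IsDominant v) :
    v ∈ weightLattice n := fun α hα => by
  obtain ⟨m, hm⟩ := hv α hα
  exact ⟨m, by rw [hm]; push_cast; rfl⟩

lemma rho_mem_weightLattice (n : ℕ) : rho n ∈ weightLattice n :=
  fun α hα => ⟨1, by rw [rho_dot_simpleRoot hα]; norm_num⟩

lemma weylGroup_apply_mem_weightLattice {n : ℕ} (w : weylGroup n) {v : Fin n → ℚ}
    (hv : v ∈ weightLattice n) : w.1 v ∈ weightLattice n := by
  induction w using weylGroup_induction with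
  | one => exact hv
  | mul α hα w ih =>
    rw [coe_mul_apply, simpleRefl_apply]
    obtain ⟨m, hm⟩ := ih α hα
    rw [hm, Int.cast_smul_eq_zsmul]
    exact sub_mem ih (zsmul_mem (simpleRoot_mem_weightLattice hα) m)

/-- Every Weyl group orbit meets the closed dominant chamber: take the point of the orbit with the
largest pairing with `ρ`. -/
lemma exists_dominant_conj {n : ℕ} (v : Fin n → ℚ) :
    ∃ w : weylGroup n, ∀ α ∈ simpleRoots n, 0 ≤ w.1 v ⬝ᵥ α := by
  obtain ⟨w, hw⟩ := Finite.exists_max fun w : weylGroup n => w.1 v ⬝ᵥ rho n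
  refine ⟨w, fun α hα => ?_⟩
  have h := hw (simpleRefl α hα * w)
  rw [coe_mul_apply, simpleRefl_apply, sub_dotProduct, smul_dotProduct,
    dotProduct_comm α (rho n), rho_dot_simpleRoot hα, smul_eq_mul] at h
  linarith

/-- A weight shifted by `ρ` is either conjugate to a vector fixed by a simple reflection, or
conjugate to a shifted dominant weight. -/
lemma singular_or_conj_dominant {n : ℕ} {β : Fin n → ℚ} (hβ : β ∈ weightLattice n) :
    (∃ (w : weylGroup n) (α : Fin n → ℚ), α ∈ simpleRoots n ∧ w.1 (β + rho n) ⬝ᵥ α = 0) ∨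
      ∃ (γ : Dom n) (w : weylGroup n), w.1 (γ.1 + rho n) = β + rho n := by
  obtain ⟨w, hw⟩ := exists_dominant_conj (β + rho n)
  by_cases h0 : ∃ α ∈ simpleRoots n, w.1 (β + rho n) ⬝ᵥ α = 0
  · obtain ⟨α, hα, h⟩ := h0
    exact Or.inl ⟨w, α, hα, h⟩
  · push Not at h0
    refine Or.inr ⟨⟨w.1 (β + rho n) - rho n, fun α hα => ?_⟩, w⁻¹, ?_⟩
    · obtain ⟨m, hm⟩ := weylGroup_apply_mem_weightLattice w
        (add_mem hβ (rho_mem_weightLattice n)) α hα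
      have hpos : 0 < w.1 (β + rho n) ⬝ᵥ α := lt_of_le_of_ne (hw α hα) (h0 α hα).symm
      rw [hm] at hpos
      have hm1 : 0 < m := by exact_mod_cast hpos
      refine ⟨(m - 1).toNat, ?_⟩
      rw [sub_dotProduct, hm, rho_dot_simpleRoot hα, ← Int.cast_natCast,
        Int.toNat_of_nonneg (by omega)]
      push_cast; rfl
    · rw [sub_add_cancel, coe_inv_apply_apply]

/-! ### Regular dominant vectors have trivial stabilizers -/

/-- A strictly dominant vector has `u_i > |u_{i+1}|` at all consecutive positions. -/
lemma abs_lt_of_strictlyDominant {n : ℕ} {u : Fin n → ℚ} (hu : ∀ α ∈ simpleRoots n, 0 < u ⬝ᵥ α)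
    {i j : Fin n} (hij : (i : ℕ) + 1 = j) : |u j| < u i := by
  obtain ⟨d, hd⟩ : ∃ d, (j : ℕ) + 1 + d = n := ⟨n - (j + 1), by have := j.2; omega⟩
  induction d generalizing i j with
  | zero =>
    have h1 := hu _ (mem_simpleRoots_sub hij)
    have h2 := hu _ (mem_simpleRoots_add hij (by omega))
    rw [dot_eps_sub] at h1
    rw [dot_eps_add] at h2
    exact abs_lt.2 ⟨by linarith, by linarith⟩
  | succ d ih =>
    have h1 := hu _ (mem_simpleRoots_sub hij)
    rw [dot_eps_sub] at h1
    have h2 := ih (i := j) (j := ⟨j + 1, by omega⟩) rfl (by simp only; omega)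
    have h3 : 0 < u j := (abs_nonneg _).trans_lt h2
    rw [abs_of_pos h3]; linarith

lemma strictAnti_abs_of_strictlyDominant {n : ℕ} {u : Fin n → ℚ}
    (hu : ∀ α ∈ simpleRoots n, 0 < u ⬝ᵥ α) : StrictAnti fun i => |u i| := by
  cases n with
  | zero => intro i; exact i.elim0
  | succ n =>
    rw [Fin.strictAnti_iff_succ_lt]
    intro i
    exact (abs_lt_of_strictlyDominant hu (i := i.castSucc) (j := i.succ) (by simp)).trans_le
      (le_abs_self _)

/-- A strictly dominant vector is conjugate to a strictly dominant vector only by the identity: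
the absolute values of the coordinates are decreasing, which determines the permutation; all but the
last coordinates are positive, which determines their signs; the last sign follows by parity. -/
lemma eq_one_of_strictlyDominant {n : ℕ} (hn : 2 ≤ n) {u : Fin n → ℚ}
    (hu : ∀ α ∈ simpleRoots n, 0 < u ⬝ᵥ α) {w : weylGroup n}
    (hw : ∀ α ∈ simpleRoots n, 0 < w.1 u ⬝ᵥ α) : w = 1 := by
  obtain ⟨π, s, hs, hprod, h⟩ := exists_signedPerm w
  have habs : ∀ i, |w.1 u i| = |u (π i)| := fun i => by
    rw [h, abs_mul]; rcases hs i with h | h <;> simp [h]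
  have hπ : StrictMono π := fun i j hij => by
    have h1 := strictAnti_abs_of_strictlyDominant hw hij
    simp only [habs] at h1
    exact (strictAnti_abs_of_strictlyDominant hu).lt_iff_gt.1 h1
  have hid : ∀ i, π i = i := fun i =>
    congrFun ((StrictMono.range_inj hπ strictMono_id).1 (by simp)) i
  have hs1 : ∀ i : Fin n, (i : ℕ) + 1 < n → s i = 1 := fun i hi => by
    have h1 := (abs_nonneg _).trans_lt
      (abs_lt_of_strictlyDominant hu (i := i) (j := ⟨i + 1, hi⟩) rfl)
    have h2 := (abs_nonneg _).trans_lt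
      (abs_lt_of_strictlyDominant hw (i := i) (j := ⟨i + 1, hi⟩) rfl)
    rw [h, hid] at h2
    rcases hs i with h | h
    · exact h
    · rw [h] at h2; linarith
  have hlast : s ⟨n - 1, by omega⟩ = 1 := by
    rw [← hprod, eq_comm]
    refine Finset.prod_eq_single _ (fun i _ hi => hs1 i ?_) (by simp)
    have : (i : ℕ) ≠ n - 1 := fun h => hi (Fin.ext h)
    have := i.2
    omega
  apply Subtype.ext
  apply LinearEquiv.ext
  intro v
  ext i
  rw [h, hid]
  by_cases hi : (i : ℕ) + 1 < n
  · rw [hs1 i hi, one_mul]; rfl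
  · have : i = ⟨n - 1, by omega⟩ := Fin.ext (by have := i.2; simp only; omega)
    rw [this, hlast, one_mul]; rfl

lemma IsDominant.strictlyDominant_add_rho {n : ℕ} {γ : Fin n → ℚ} (h : IsDominant γ) :
    ∀ α ∈ simpleRoots n, 0 < (γ + rho n) ⬝ᵥ α := fun α hα => by
  obtain ⟨m, hm⟩ := h α hα
  rw [add_dotProduct, hm, rho_dot_simpleRoot hα]
  positivity

lemma eq_one_of_apply_add_rho_eq {n : ℕ} (hn : 2 ≤ n) {γ δ : Dom n} {w : weylGroup n}
    (h : w.1 (γ.1 + rho n) = δ.1 + rho n) : w = 1 ∧ γ = δ := by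
  have hw : w = 1 := eq_one_of_strictlyDominant hn γ.2.strictlyDominant_add_rho
    (by rw [h]; exact δ.2.strictlyDominant_add_rho)
  refine ⟨hw, Subtype.ext ?_⟩
  subst hw
  exact add_right_cancel h

/-! ### Alternation over the Weyl group -/

instance charZero_groupRing (n : ℕ) : CharZero (GroupRing n) :=
  charZero_of_injective_ringHom (f := (AddMonoidAlgebra.singleZeroRingHom : ℤ →+* GroupRing n))
    fun a b h => by
      have h' : Finsupp.single (0 : Fin n → ℚ) a = Finsupp.single 0 b :=
        congrArg AddMonoidAlgebra.coeff h
      exact Finsupp.single_injective 0 h'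

instance charZero_charField (n : ℕ) : CharZero (CharField n) :=
  charZero_of_injective_algebraMap (IsFractionRing.injective (GroupRing n) (CharField n))

/-- The formal exponential `x^β`. -/
abbrev expo {n : ℕ} (β : Fin n → ℚ) : GroupRing n := AddMonoidAlgebra.single β 1

lemma expo_mul {n : ℕ} (β γ : Fin n → ℚ) : expo β * expo γ = expo (β + γ) := by
  rw [AddMonoidAlgebra.single_mul_single, one_mul]

/-- The action of the Weyl group on the group ring. -/
def weylAct {n : ℕ} (w : weylGroup n) : GroupRing n →+* GroupRing n :=
  AddMonoidAlgebra.mapDomainRingHom ℤ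
    ((w.1 : (Fin n → ℚ) →ₗ[ℚ] (Fin n → ℚ)) : (Fin n → ℚ) →+ (Fin n → ℚ))

@[simp] lemma weylAct_single {n : ℕ} (w : weylGroup n) (β : Fin n → ℚ) (c : ℤ) :
    weylAct w (AddMonoidAlgebra.single β c) = AddMonoidAlgebra.single (w.1 β) c :=
  AddMonoidAlgebra.mapDomain_single

lemma weylAct_mul {n : ℕ} (v w : weylGroup n) (f : GroupRing n) :
    weylAct (v * w) f = weylAct v (weylAct w f) := by
  induction f using AddMonoidAlgebra.induction_linear with
  | zero => simp
  | add f g hf hg => simp [hf, hg]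
  | single β c => simp

lemma coeff_weylAct {n : ℕ} (w : weylGroup n) (f : GroupRing n) (β : Fin n → ℚ) :
    (weylAct w f).coeff (w.1 β) = f.coeff β := by
  induction f using AddMonoidAlgebra.induction_linear with
  | zero => simp
  | add f g hf hg => simp [hf, hg]
  | single β c => simp [Finsupp.single_apply]

/-- The alternating sum `∑_w (-1)^{ℓ(w)} w(f)` of an element of the group ring. -/
def alternate {n : ℕ} : GroupRing n →ₗ[ℤ] GroupRing n :=
  ∑ w : weylGroup n, weylSign w • (weylAct w : GroupRing n →+ GroupRing n).toIntLinearMap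

lemma alternate_apply {n : ℕ} (f : GroupRing n) :
    alternate f = ∑ w : weylGroup n, weylSign w • weylAct w f := by
  simp [alternate]

lemma alternate_expo {n : ℕ} (β : Fin n → ℚ) : alternate (expo β) = alt β := by
  rw [alternate_apply, alt]
  refine Finset.sum_congr rfl fun w _ => ?_
  rw [weylAct_single, AddMonoidAlgebra.smul_single, smul_eq_mul, mul_one, weylSign]

lemma alternate_weylAct {n : ℕ} (v : weylGroup n) (f : GroupRing n) :
    alternate (weylAct v f) = weylSign v • alternate f := by
  rw [alternate_apply, alternate_apply, Finset.smul_sum, ← Equiv.sum_comp (Equiv.mulRight v⁻¹)]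
  refine Finset.sum_congr rfl fun w _ => ?_
  rw [Equiv.coe_mulRight, ← weylAct_mul, inv_mul_cancel_right, weylSign_mul, weylSign_inv,
    smul_smul, mul_comm]

lemma alternate_mul_of_invariant {n : ℕ} {g : GroupRing n} (hg : ∀ w, weylAct w g = g)
    (f : GroupRing n) : alternate (g * f) = g * alternate f := by
  simp only [alternate_apply, Finset.mul_sum, map_mul, hg, mul_smul_comm]

lemma alt_apply {n : ℕ} (v : weylGroup n) (β : Fin n → ℚ) :
    alt (v.1 β) = weylSign v • alt β := by
  rw [← alternate_expo, ← alternate_expo, ← alternate_weylAct, weylAct_single]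

lemma alt_simpleRefl {n : ℕ} {α : Fin n → ℚ} (hα : α ∈ simpleRoots n) (β : Fin n → ℚ) :
    alt (β - (β ⬝ᵥ α) • α) = -alt β := by
  rw [← simpleRefl_apply hα, alt_apply, weylSign_simpleRefl, neg_one_zsmul]

lemma alt_eq_zero {n : ℕ} {α : Fin n → ℚ} (hα : α ∈ simpleRoots n) {β : Fin n → ℚ}
    (h : β ⬝ᵥ α = 0) : alt β = 0 := by
  have := alt_simpleRefl hα β
  rw [h, zero_smul, sub_zero] at this
  exact self_eq_neg.1 this

/-! ### Functionals that are antisymmetric for the dot action -/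

/-- A functional on the group ring is antisymmetric for the dot action
`w · β = w(β + ρ) - ρ` of the Weyl group. -/
def IsDotAntisymmetric {n : ℕ} {V : Type*} [AddCommGroup V] (Φ : GroupRing n →ₗ[ℤ] V) : Prop :=
  ∀ (w : weylGroup n) (β : Fin n → ℚ),
    Φ (expo (w.1 (β + rho n) - rho n)) = weylSign w • Φ (expo β)

lemma IsDotAntisymmetric.of_simpleRefl {n : ℕ} {V : Type*} [AddCommGroup V]
    {Φ : GroupRing n →ₗ[ℤ] V}
    (h : ∀ α ∈ simpleRoots n, ∀ β : Fin n → ℚ,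
      Φ (expo (β - ((β + rho n) ⬝ᵥ α) • α)) = -Φ (expo β)) : IsDotAntisymmetric Φ := by
  intro w
  induction w using weylGroup_induction with
  | one =>
    intro β
    rw [weylSign_one, one_smul]
    congr 2
    exact add_sub_cancel_right β _
  | mul α hα w ih =>
    intro β
    have := h α hα (w.1 (β + rho n) - rho n)
    rw [ih, sub_add_cancel] at this
    rw [weylSign_mul, weylSign_simpleRefl, neg_one_mul, neg_smul, ← this, coe_mul_apply,
      simpleRefl_apply]
    congr 2
    abel

lemma IsDotAntisymmetric.eq_zero_of_singular {n : ℕ} {V : Type*} [AddCommGroup V]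
    [IsAddTorsionFree V] {Φ : GroupRing n →ₗ[ℤ] V} (h : IsDotAntisymmetric Φ) {β : Fin n → ℚ}
    {w : weylGroup n} {α : Fin n → ℚ} (hα : α ∈ simpleRoots n)
    (h0 : w.1 (β + rho n) ⬝ᵥ α = 0) : Φ (expo β) = 0 := by
  have h1 := h w β
  have h2 := h (simpleRefl α hα * w) β
  rw [coe_mul_apply, simpleRefl_apply, h0, zero_smul, sub_zero, h1, weylSign_mul,
    weylSign_simpleRefl, neg_one_mul, neg_smul] at h2
  have h3 := congrArg (weylSign w • ·) (self_eq_neg.1 h2)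
  simpa only [smul_smul, weylSign_mul_self, one_smul, smul_zero] using h3

/-- The dot action extends to the group ring as `f ↦ x^{-ρ} w(x^ρ f)`, and antisymmetry extends along
with it. -/
lemma IsDotAntisymmetric.apply_twist {n : ℕ} {V : Type*} [AddCommGroup V]
    {Φ : GroupRing n →ₗ[ℤ] V} (h : IsDotAntisymmetric Φ) (w : weylGroup n) (f : GroupRing n) :
    Φ (expo (-rho n) * weylAct w (expo (rho n) * f)) = weylSign w • Φ f := by
  induction f using AddMonoidAlgebra.induction_linear with
  | zero => simp
  | add f g hf hg => rw [mul_add, map_add, mul_add, map_add, hf, hg, map_add, smul_add]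
  | single β c =>
    have hc : (AddMonoidAlgebra.single β c : GroupRing n) = c • expo β := by simp
    rw [hc, mul_smul_comm, map_zsmul, mul_smul_comm, map_zsmul, map_zsmul, expo_mul,
      weylAct_single, expo_mul, smul_comm (weylSign w), ← h w β, add_comm (rho n), neg_add_eq_sub]

lemma IsDotAntisymmetric.mul_invariant {n : ℕ} {V : Type*} [AddCommGroup V]
    {Φ : GroupRing n →ₗ[ℤ] V} (h : IsDotAntisymmetric Φ) {g : GroupRing n}
    (hg : ∀ w, weylAct w g = g) : IsDotAntisymmetric (Φ ∘ₗ LinearMap.mulLeft ℤ g) := by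
  intro w β
  simp only [LinearMap.comp_apply, LinearMap.mulLeft_apply]
  rw [← h.apply_twist, mul_left_comm, (weylAct w).map_mul, hg, expo_mul, weylAct_single,
    mul_left_comm, expo_mul, add_comm (rho n), neg_add_eq_sub]

/-- The coefficient of the dominant weight `γ` in the straightened form of an element of the group
ring: the functional `f ↦ ∑_w (-1)^{ℓ(w)} [x^{w · γ}] f`. -/
def domCoeff {n : ℕ} (γ : Dom n) : GroupRing n →ₗ[ℤ] ℤ :=
  ∑ w : weylGroup n, weylSign w •
    (Finsupp.lapply (w.1 (γ.1 + rho n) - rho n) ∘ₗ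
      (AddMonoidAlgebra.coeffLinearEquiv ℤ (S := ℤ) (M := Fin n → ℚ)).toLinearMap)

lemma domCoeff_apply {n : ℕ} (γ : Dom n) (f : GroupRing n) :
    domCoeff γ f = ∑ w : weylGroup n, weylSign w * f.coeff (w.1 (γ.1 + rho n) - rho n) := by
  simp [domCoeff]

lemma isDotAntisymmetric_domCoeff {n : ℕ} (γ : Dom n) : IsDotAntisymmetric (domCoeff γ) := by
  intro v β
  rw [domCoeff_apply, domCoeff_apply, smul_eq_mul, Finset.mul_sum,
    ← Equiv.sum_comp (Equiv.mulLeft v)]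
  refine Finset.sum_congr rfl fun w _ => ?_
  rw [Equiv.coe_mulLeft, weylSign_mul, mul_assoc]
  congr 2
  have : (v.1 (β + rho n) - rho n = (v * w).1 (γ.1 + rho n) - rho n) ↔
      (β = w.1 (γ.1 + rho n) - rho n) := by
    rw [coe_mul_apply, sub_left_inj, v.1.injective.eq_iff, eq_sub_iff_add_eq]
  simp only [AddMonoidAlgebra.coeff_single, Finsupp.single_apply, this]

lemma domCoeff_expo {n : ℕ} (hn : 2 ≤ n) (γ δ : Dom n) :
    domCoeff γ (expo δ.1) = Finsupp.single δ (1 : ℤ) γ := by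
  have hiff : ∀ w : weylGroup n, δ.1 = w.1 (γ.1 + rho n) - rho n ↔ w = 1 ∧ γ = δ := fun w => by
    rw [eq_sub_iff_add_eq]
    constructor
    · exact fun h => eq_one_of_apply_add_rho_eq hn h.symm
    · rintro ⟨rfl, rfl⟩; rfl
  rw [domCoeff_apply, Finset.sum_eq_single 1]
  · rw [weylSign_one, one_mul]
    by_cases h : δ = γ <;> simp [h, Subtype.ext_iff.symm]
  · intro w _ hw
    rw [AddMonoidAlgebra.coeff_single, Finsupp.single_apply, if_neg, mul_zero]
    rw [hiff]
    exact fun h => hw h.1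
  · simp

lemma finite_domCoeff_ne_zero {n : ℕ} (f : GroupRing n) :
    {γ : Dom n | domCoeff γ f ≠ 0}.Finite := by
  have hfin : (⋃ w : weylGroup n,
      (fun γ : Dom n => w.1 (γ.1 + rho n) - rho n) ⁻¹'
        (f.coeff.support : Set (Fin n → ℚ))).Finite :=
    Set.finite_iUnion fun w => f.coeff.support.finite_toSet.preimage fun γ _ δ _ h =>
      Subtype.ext (add_right_cancel (w.1.injective (sub_left_injective h)))
  refine hfin.subset fun γ hγ => ?_
  rw [Set.mem_ofPred_eq, domCoeff_apply] at hγ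
  obtain ⟨w, -, hw⟩ := Finset.exists_ne_zero_of_sum_ne_zero hγ
  exact Set.mem_iUnion.2 ⟨w, Finsupp.mem_support_iff.2 (right_ne_zero_of_mul hw)⟩

/-- The straightening map, which rewrites an element of the group ring as a combination of dominant
weights by means of the dot action. -/
def straighten {n : ℕ} : GroupRing n →ₗ[ℤ] (Dom n →₀ ℤ) where
  toFun f := Finsupp.ofSupportFinite (fun γ => domCoeff γ f) (finite_domCoeff_ne_zero f)
  map_add' f g := by ext γ; exact map_add (domCoeff γ) f g
  map_smul' c f := by ext γ; exact map_smul (domCoeff γ) c f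

lemma straighten_apply {n : ℕ} (f : GroupRing n) (γ : Dom n) :
    straighten f γ = domCoeff γ f := rfl

/-- The group ring of the weight lattice. -/
def weightSpan (n : ℕ) : Submodule ℤ (GroupRing n) :=
  Submodule.span ℤ (expo '' (weightLattice n : Set (Fin n → ℚ)))

lemma expo_mem_weightSpan {n : ℕ} {β : Fin n → ℚ} (hβ : β ∈ weightLattice n) :
    expo β ∈ weightSpan n := Submodule.subset_span ⟨β, hβ, rfl⟩

lemma mul_expo_mem_weightSpan {n : ℕ} {f : GroupRing n} (hf : f ∈ weightSpan n) {β : Fin n → ℚ}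
    (hβ : β ∈ weightLattice n) : f * expo β ∈ weightSpan n := by
  induction hf using Submodule.span_induction with
  | mem x hx =>
    obtain ⟨γ, hγ, rfl⟩ := hx
    rw [expo_mul]
    exact expo_mem_weightSpan (add_mem hγ hβ)
  | zero => simp
  | add x y _ _ hx hy => rw [add_mul]; exact add_mem hx hy
  | smul c x _ hx => rw [smul_mul_assoc]; exact Submodule.smul_mem _ _ hx

/-- Straightening: an antisymmetric functional sees an element of the group ring of the weight
lattice only through its straightened form. -/
lemma IsDotAntisymmetric.apply_eq_straighten {n : ℕ} (hn : 2 ≤ n) {V : Type*} [AddCommGroup V]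
    [IsAddTorsionFree V] {Φ : GroupRing n →ₗ[ℤ] V} (h : IsDotAntisymmetric Φ) {f : GroupRing n}
    (hf : f ∈ weightSpan n) :
    Φ f = (straighten f).sum fun γ m => m • Φ (expo γ.1) := by
  change Φ f = Finsupp.linearCombination ℤ (fun γ : Dom n => Φ (expo γ.1)) (straighten f)
  induction hf using Submodule.span_induction with
  | mem x hx =>
    obtain ⟨β, hβ, rfl⟩ := hx
    rcases singular_or_conj_dominant hβ with ⟨w, α, hα, h0⟩ | ⟨γ, w, hw⟩
    · have hs : straighten (expo β) = 0 := by
        ext γ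
        exact (isDotAntisymmetric_domCoeff γ).eq_zero_of_singular hα h0
      rw [h.eq_zero_of_singular hα h0, hs, map_zero]
    · have hβ' : β = w.1 (γ.1 + rho n) - rho n := by rw [hw, add_sub_cancel_right]
      have hs : straighten (expo β) = weylSign w • Finsupp.single γ 1 := by
        ext δ
        rw [straighten_apply, hβ', isDotAntisymmetric_domCoeff δ w, domCoeff_expo hn]
        rfl
      rw [hs, map_smul, Finsupp.linearCombination_single, one_smul, hβ', h w]
  | zero => simp
  | add x y _ _ hx hy => rw [map_add, map_add, map_add, hx, hy]
  | smul c x _ hx => rw [map_smul, map_smul, map_smul, hx]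

/-! ### Schur functions and tensor product multiplicities -/

lemma coeff_weylAct_eq {n : ℕ} (w : weylGroup n) (f : GroupRing n) (β : Fin n → ℚ) :
    (weylAct w f).coeff β = f.coeff ((w⁻¹).1 β) := by
  conv_lhs => rw [← coe_apply_inv_apply w β, coeff_weylAct]

lemma coeff_alternate {n : ℕ} (f : GroupRing n) (lam : Dom n) :
    (alternate (expo (rho n) * f)).coeff (lam.1 + rho n) = domCoeff lam f := by
  rw [alternate_apply, AddMonoidAlgebra.coeff_sum, Finsupp.finsetSum_apply, domCoeff_apply,
    ← Equiv.sum_comp (Equiv.inv (weylGroup n))]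
  refine Finset.sum_congr rfl fun w _ => ?_
  rw [Equiv.inv_apply, weylSign_inv, AddMonoidAlgebra.coeff_smul, Finsupp.smul_apply, smul_eq_mul,
    coeff_weylAct_eq, inv_inv, AddMonoidAlgebra.coeff_single_mul_apply, one_mul, neg_add_eq_sub]

lemma isDominant_zero (n : ℕ) : IsDominant (0 : Fin n → ℚ) := fun α _ => ⟨0, by simp⟩

lemma alt_rho_ne_zero {n : ℕ} (hn : 2 ≤ n) : alt (rho n) ≠ 0 := by
  intro h
  have h1 := coeff_alternate (expo 0) (⟨0, isDominant_zero n⟩ : Dom n)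
  have h2 := domCoeff_expo hn (⟨0, isDominant_zero n⟩ : Dom n) ⟨0, isDominant_zero n⟩
  rw [h2, expo_mul, add_zero, alternate_expo, h] at h1
  simp at h1

lemma algebraMap_alt_rho_ne_zero {n : ℕ} (hn : 2 ≤ n) :
    algebraMap (GroupRing n) (CharField n) (alt (rho n)) ≠ 0 := fun h =>
  alt_rho_ne_zero hn (IsFractionRing.injective (GroupRing n) (CharField n) (by rw [h, map_zero]))

/-- The linear functional `x^β ↦ s_β`. -/
def schurHom (n : ℕ) : GroupRing n →ₗ[ℤ] CharField n :=
  LinearMap.mulRight ℤ (algebraMap (GroupRing n) (CharField n) (alt (rho n)))⁻¹ ∘ₗ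
    (algebraMap (GroupRing n) (CharField n) : GroupRing n →+ CharField n).toIntLinearMap ∘ₗ
      alternate ∘ₗ LinearMap.mulLeft ℤ (expo (rho n))

lemma schurHom_apply {n : ℕ} (f : GroupRing n) :
    schurHom n f = algebraMap (GroupRing n) (CharField n) (alternate (expo (rho n) * f)) /
      algebraMap (GroupRing n) (CharField n) (alt (rho n)) := rfl

lemma schurHom_expo {n : ℕ} (β : Fin n → ℚ) : schurHom n (expo β) = schur β := by
  rw [schurHom_apply, expo_mul, alternate_expo, add_comm, schur]

lemma schur_simpleRefl {n : ℕ} {α : Fin n → ℚ} (hα : α ∈ simpleRoots n) (β : Fin n → ℚ) :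
    schur (β - ((β + rho n) ⬝ᵥ α) • α) = -schur β := by
  rw [schur, schur, sub_add_eq_add_sub, alt_simpleRefl hα, map_neg, neg_div]

lemma isDotAntisymmetric_schurHom (n : ℕ) : IsDotAntisymmetric (schurHom n) :=
  .of_simpleRefl fun α hα β => by rw [schurHom_expo, schurHom_expo, schur_simpleRefl hα]

lemma schurHom_mul_of_invariant {n : ℕ} {g : GroupRing n} (hg : ∀ w, weylAct w g = g)
    (f : GroupRing n) :
    schurHom n (g * f) = algebraMap (GroupRing n) (CharField n) g * schurHom n f := by
  rw [schurHom_apply, schurHom_apply, mul_left_comm, alternate_mul_of_invariant hg, map_mul,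
    mul_div_assoc]

/-- The combination of exponentials of dominant weights with given coefficients. -/
def domSum {n : ℕ} (c : Dom n →₀ ℤ) : GroupRing n :=
  Finsupp.linearCombination ℤ (fun γ : Dom n => expo γ.1) c

lemma schurHom_domSum {n : ℕ} (c : Dom n →₀ ℤ) :
    schurHom n (domSum c) = c.sum fun ν m => (m : CharField n) * schur ν.1 := by
  rw [domSum, Finsupp.linearCombination_apply, map_finsuppSum]
  simp only [map_smul, schurHom_expo]
  simp only [zsmul_eq_mul]

lemma domCoeff_domSum {n : ℕ} (hn : 2 ≤ n) (c : Dom n →₀ ℤ) (lam : Dom n) :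
    domCoeff lam (domSum c) = c lam := by
  rw [domSum, Finsupp.linearCombination_apply, map_finsuppSum]
  simp only [map_smul, domCoeff_expo hn, smul_eq_mul]
  rw [Finsupp.sum, Finset.sum_eq_single lam]
  · simp
  · intro b _ hb; simp [hb]
  · intro h; simp [Finsupp.notMem_support_iff.1 h]

/-- The Schur functions of dominant weights are linearly independent: the coefficient of `s_λ` is
the coefficient of `x^{λ + ρ}` after multiplication by `a_ρ`. -/
lemma domSum_schur_injective {n : ℕ} (hn : 2 ≤ n) {c c' : Dom n →₀ ℤ}
    (h : (c.sum fun ν m => (m : CharField n) * schur ν.1) =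
      c'.sum fun ν m => (m : CharField n) * schur ν.1) : c = c' := by
  rw [← schurHom_domSum, ← schurHom_domSum, schurHom_apply, schurHom_apply,
    div_left_inj' (algebraMap_alt_rho_ne_zero hn)] at h
  have h' := IsFractionRing.injective (GroupRing n) (CharField n) h
  ext lam
  rw [← domCoeff_domSum hn c, ← domCoeff_domSum hn c', ← coeff_alternate, ← coeff_alternate, h']

/-- If the Schur function `s_δ` is the invariant element `χ` of the group ring, then the
multiplicity of `V(λ)` in `V(γ) ⊗ V(δ)` is the coefficient of `λ` in the straightened form of
`χ x^γ` (Brauer's formula). -/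
lemma tensorMult_eq {n : ℕ} (hn : 2 ≤ n) {χ : GroupRing n} {δ : Fin n → ℚ}
    (hW : ∀ w, weylAct w χ = χ) (hχ : χ * alt (rho n) = alt (δ + rho n))
    (hmem : χ ∈ weightSpan n) (γ lam : Dom n) :
    tensorMult γ δ lam = domCoeff lam (χ * expo γ.1) := by
  have hs : schur δ = algebraMap (GroupRing n) (CharField n) χ := by
    rw [schur, ← hχ, map_mul, mul_div_cancel_right₀ _ (algebraMap_alt_rho_ne_zero hn)]
  have hex : schur γ.1 * schur δ =
      (straighten (χ * expo γ.1)).sum fun ν m => (m : CharField n) * schur ν.1 := by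
    rw [hs, ← schurHom_expo, mul_comm, ← schurHom_mul_of_invariant hW,
      (isDotAntisymmetric_schurHom n).apply_eq_straighten hn
        (mul_expo_mem_weightSpan hmem γ.2.mem_weightLattice)]
    simp only [schurHom_expo, zsmul_eq_mul]
  have h : ∃ c : Dom n →₀ ℤ, schur γ.1 * schur δ = c.sum fun ν m => (m : CharField n) * schur ν.1 :=
    ⟨_, hex⟩
  rw [tensorMult, dif_pos h, domSum_schur_injective hn (h.choose_spec.symm.trans hex)]
  rfl

/-- Multiplication by an invariant element whose weight multiplicities are even functions is
self-adjoint for straightening; for the character of a self-dual module `V` this says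
`[V(γ) ⊗ V : V(λ)] = [V(λ) ⊗ V : V(γ)]`. -/
lemma domCoeff_mul_symm {n : ℕ} {χ : GroupRing n} (hW : ∀ w, weylAct w χ = χ)
    (hneg : ∀ β, χ.coeff (-β) = χ.coeff β) (γ lam : Dom n) :
    domCoeff lam (χ * expo γ.1) = domCoeff γ (χ * expo lam.1) := by
  rw [domCoeff_apply, domCoeff_apply, ← Equiv.sum_comp (Equiv.inv (weylGroup n))]
  refine Finset.sum_congr rfl fun w _ => ?_
  have hinv : ∀ β, χ.coeff (w.1 β) = χ.coeff β := fun β => by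
    conv_lhs => rw [← hW w, coeff_weylAct]
  rw [Equiv.inv_apply, weylSign_inv, AddMonoidAlgebra.coeff_mul_single_apply,
    AddMonoidAlgebra.coeff_mul_single_apply, ← hinv, ← hneg]
  congr 3
  rw [map_add, map_sub, map_neg, coe_apply_inv_apply]
  have : w.1 (γ.1 + rho n) = w.1 γ.1 + w.1 (rho n) := map_add _ _ _
  rw [this]
  abel

/-! ### Schur functions of rank `n + 1` as functionals in rank `n` -/

/-- The linear extension of a function on exponents to the group ring. -/
def linExt {n : ℕ} {V : Type*} [AddCommGroup V] (φ : (Fin n → ℚ) → V) : GroupRing n →ₗ[ℤ] V :=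
  Finsupp.linearCombination ℤ φ ∘ₗ
    (AddMonoidAlgebra.coeffLinearEquiv ℤ (S := ℤ) (M := Fin n → ℚ)).toLinearMap

lemma linExt_expo {n : ℕ} {V : Type*} [AddCommGroup V] (φ : (Fin n → ℚ) → V) (β : Fin n → ℚ) :
    linExt φ (expo β) = φ β := by
  change Finsupp.linearCombination ℤ φ (Finsupp.single β 1) = _
  simp

lemma cons_zero_eps {n : ℕ} (i : Fin n) :
    (Fin.cons 0 (eps i) : Fin (n + 1) → ℚ) = eps i.succ := by
  ext k
  refine Fin.cases ?_ (fun k => ?_) k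
  · simp [eps]
  · simp [eps, Pi.single_apply]

lemma cons_add_cons {n : ℕ} (a b : ℚ) (v w : Fin n → ℚ) :
    (Fin.cons a v + Fin.cons b w : Fin (n + 1) → ℚ) = Fin.cons (a + b) (v + w) := by
  ext k
  refine Fin.cases ?_ (fun k => ?_) k <;> simp

lemma smul_cons {n : ℕ} (c a : ℚ) (v : Fin n → ℚ) :
    (c • Fin.cons a v : Fin (n + 1) → ℚ) = Fin.cons (c * a) (c • v) := by
  ext k
  refine Fin.cases ?_ (fun k => ?_) k <;> simp

lemma cons_zero_mem_simpleRoots {n : ℕ} {α : Fin n → ℚ} (hα : α ∈ simpleRoots n) :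
    (Fin.cons 0 α : Fin (n + 1) → ℚ) ∈ simpleRoots (n + 1) := by
  rcases hα with ⟨i, j, hij, rfl⟩ | ⟨i, j, hij, hj, rfl⟩
  · have : (Fin.cons 0 (eps i - eps j) : Fin (n + 1) → ℚ) = eps i.succ - eps j.succ := by
      rw [← cons_zero_eps, ← cons_zero_eps]
      ext k
      refine Fin.cases ?_ (fun k => ?_) k <;> simp
    rw [this]
    exact mem_simpleRoots_sub (by simp [hij])
  · have : (Fin.cons 0 (eps i + eps j) : Fin (n + 1) → ℚ) = eps i.succ + eps j.succ := by
      rw [← cons_zero_eps, ← cons_zero_eps, cons_add_cons, add_zero]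
    rw [this]
    exact mem_simpleRoots_add (by simp [hij]) (by simp [hj])

lemma rho_succ (n : ℕ) : rho (n + 1) = (Fin.cons (n : ℚ) (rho n) : Fin (n + 1) → ℚ) := by
  ext k
  refine Fin.cases ?_ (fun k => ?_) k
  · simp [rho_apply]
  · simp only [rho_apply, Fin.cons_succ, Fin.val_succ]; push_cast; ring

lemma dotProduct_cons_zero {n : ℕ} (v : Fin (n + 1) → ℚ) (α : Fin n → ℚ) :
    v ⬝ᵥ (Fin.cons 0 α : Fin (n + 1) → ℚ) = Fin.tail v ⬝ᵥ α := by
  simp [dotProduct, Fin.sum_univ_succ, Fin.tail]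

/-- The functional `x^δ ↦ s_{(a, δ)}` from rank `n` to rank `n + 1`. -/
def schurCons {n : ℕ} (a : ℚ) : GroupRing n →ₗ[ℤ] CharField (n + 1) :=
  linExt fun δ => schur (Fin.cons a δ : Fin (n + 1) → ℚ)

lemma isDotAntisymmetric_schurCons {n : ℕ} (a : ℚ) :
    IsDotAntisymmetric (schurCons (n := n) a) := by
  refine .of_simpleRefl fun α hα β => ?_
  rw [schurCons, linExt_expo, linExt_expo,
    ← schur_simpleRefl (cons_zero_mem_simpleRoots hα), rho_succ, cons_add_cons,
    dotProduct_cons_zero, Fin.tail_cons, smul_cons, mul_zero]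
  congr 1
  ext k
  refine Fin.cases ?_ (fun k => ?_) k <;> simp

/-! ### Generating functions over the group ring -/

/-- The geometric series `∑_k q^k x^{k v} = (1 - q x^v)⁻¹`. -/
def geom {n : ℕ} (v : Fin n → ℚ) : PowerSeries (GroupRing n) :=
  PowerSeries.mk fun k => expo ((k : ℚ) • v)

/-- The linear factor `1 - q x^v`. -/
def linFactor {n : ℕ} (v : Fin n → ℚ) : PowerSeries (GroupRing n) :=
  1 - PowerSeries.C (expo v) * PowerSeries.X

lemma linFactor_mul_geom {n : ℕ} (v : Fin n → ℚ) : linFactor v * geom v = 1 := by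
  ext k : 1
  rw [linFactor, sub_mul, one_mul, map_sub, mul_assoc, PowerSeries.coeff_C_mul]
  cases k with
  | zero => simp [geom, AddMonoidAlgebra.one_def]
  | succ k =>
    rw [PowerSeries.coeff_succ_X_mul, geom, PowerSeries.coeff_mk, PowerSeries.coeff_mk, expo_mul,
      PowerSeries.coeff_one, if_neg (Nat.succ_ne_zero k), sub_eq_zero]
    congr 1
    push_cast
    module

/-- The complete homogeneous polynomial of degree `N` in the exponentials `x^{v_i}`. -/
def complete {n : ℕ} {ι : Type*} [Fintype ι] [DecidableEq ι] (v : ι → Fin n → ℚ) (N : ℕ) :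
    GroupRing n :=
  ∑ k ∈ Finset.piAntidiag (Finset.univ : Finset ι) N, expo (∑ i, (k i : ℚ) • v i)

lemma prod_expo {n : ℕ} {ι : Type*} (s : Finset ι) (v : ι → Fin n → ℚ) :
    ∏ i ∈ s, expo (v i) = expo (∑ i ∈ s, v i) := by
  classical
  induction s using Finset.induction_on with
  | empty => simp [AddMonoidAlgebra.one_def]
  | insert a s ha ih => rw [Finset.prod_insert ha, Finset.sum_insert ha, ih, expo_mul]

lemma mk_complete {n : ℕ} {ι : Type*} [Fintype ι] [DecidableEq ι] (v : ι → Fin n → ℚ) :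
    PowerSeries.mk (complete v) = ∏ i, geom (v i) := by
  ext N : 1
  rw [PowerSeries.coeff_mk, PowerSeries.coeff_prod, complete]
  refine Finset.sum_bij' (fun k _ => Finsupp.equivFunOnFinite.symm k) (fun l _ => ⇑l) ?_ ?_ ?_ ?_ ?_
  · intro k hk
    rw [Finset.mem_piAntidiag] at hk
    rw [Finset.mem_finsuppAntidiag]
    exact ⟨hk.1, Finset.subset_univ _⟩
  · intro l hl
    rw [Finset.mem_finsuppAntidiag] at hl
    rw [Finset.mem_piAntidiag]
    exact ⟨hl.1, fun i _ => Finset.mem_univ i⟩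
  · intro k _; rfl
  · intro l _; ext; rfl
  · intro k _
    simp only [geom, PowerSeries.coeff_mk]
    rw [prod_expo]; rfl

/-! ### The symmetric powers of the vector representation -/

/-- The weights `± ε_i` of the vector representation. -/
def vectorWeight {n : ℕ} (b : Fin n × Bool) : Fin n → ℚ := if b.2 then -eps b.1 else eps b.1

lemma eps_injective {n : ℕ} : Function.Injective (eps (n := n)) := fun i j h => by
  by_contra hne
  have := congrFun h i
  simp [eps, hne] at this

lemma eps_ne_neg_eps {n : ℕ} (i j : Fin n) : eps i ≠ -eps j := fun h => by
  have := congrFun h i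
  simp only [eps, Pi.single_apply, Pi.neg_apply, if_true] at this
  split_ifs at this <;> norm_num at this

lemma vectorWeight_injective {n : ℕ} : Function.Injective (vectorWeight (n := n)) := by
  rintro ⟨i, _ | _⟩ ⟨j, _ | _⟩ h <;> simp only [vectorWeight, if_true, Bool.false_eq_true,
    if_false] at h
  · rw [eps_injective h]
  · exact (eps_ne_neg_eps i j h).elim
  · exact (eps_ne_neg_eps j i h.symm).elim
  · rw [eps_injective (neg_injective h)]

lemma range_vectorWeight (n : ℕ) : Set.range (vectorWeight (n := n)) = signedBasis n := by
  ext v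
  constructor
  · rintro ⟨⟨i, _ | _⟩, rfl⟩
    · exact Or.inl ⟨i, rfl⟩
    · exact Or.inr ⟨i, rfl⟩
  · rintro (⟨i, rfl⟩ | ⟨i, rfl⟩)
    · exact ⟨(i, false), rfl⟩
    · exact ⟨(i, true), rfl⟩

/-- Products over the weights `± ε_i` are unchanged by maps that permute these weights. -/
lemma prod_vectorWeight_comp {n : ℕ} {M : Type*} [CommMonoid M] (G : (Fin n → ℚ) → M)
    {g : (Fin n → ℚ) → (Fin n → ℚ)} (hinj : Function.Injective g)
    (hg : ∀ v ∈ signedBasis n, g v ∈ signedBasis n) :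
    ∏ b, G (g (vectorWeight b)) = ∏ b, G (vectorWeight b) := by
  have h : ∀ b : Fin n × Bool, ∃ c : Fin n × Bool, vectorWeight c = g (vectorWeight b) := by
    intro b
    have := hg (vectorWeight b) (by rw [← range_vectorWeight]; exact ⟨b, rfl⟩)
    rwa [← range_vectorWeight] at this
  choose e he using h
  have hinj' : Function.Injective e := fun b c hbc =>
    vectorWeight_injective (hinj (by rw [← he, ← he, hbc]))
  rw [← Equiv.prod_comp (Equiv.ofBijective e (Finite.injective_iff_bijective.1 hinj'))
    fun b => G (vectorWeight b)]
  exact Finset.prod_congr rfl fun b _ => by rw [Equiv.ofBijective_apply, he]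

/-- The character `h_r` of the `r`-th symmetric power of the vector representation. -/
def symChar (n r : ℕ) : GroupRing n := complete (vectorWeight (n := n)) r

lemma mapDomain_symChar {n : ℕ} (g : (Fin n → ℚ) →+ (Fin n → ℚ)) (hinj : Function.Injective g)
    (hg : ∀ v ∈ signedBasis n, g v ∈ signedBasis n) (r : ℕ) :
    AddMonoidAlgebra.mapDomainRingHom ℤ g (symChar n r) = symChar n r := by
  have h : PowerSeries.map (AddMonoidAlgebra.mapDomainRingHom ℤ g)
      (PowerSeries.mk (symChar n)) = PowerSeries.mk (symChar n) := by
    unfold symChar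
    rw [mk_complete, map_prod, ← prod_vectorWeight_comp geom hinj hg]
    refine Finset.prod_congr rfl fun b _ => ?_
    ext k : 1
    rw [PowerSeries.coeff_map, geom, geom, PowerSeries.coeff_mk, PowerSeries.coeff_mk,
      AddMonoidAlgebra.mapDomainRingHom_apply, AddMonoidAlgebra.mapDomain_single,
      Nat.cast_smul_eq_nsmul, Nat.cast_smul_eq_nsmul, map_nsmul]
  have := congrArg (PowerSeries.coeff r) h
  rwa [PowerSeries.coeff_map, PowerSeries.coeff_mk] at this

lemma weylAct_symChar {n : ℕ} (w : weylGroup n) (r : ℕ) : weylAct w (symChar n r) = symChar n r :=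
  mapDomain_symChar _ w.1.injective (fun _ hv => weylGroup_mem w.2 hv) r

lemma neg_mem_signedBasis {n : ℕ} {v : Fin n → ℚ} (hv : v ∈ signedBasis n) :
    -v ∈ signedBasis n := by
  rcases hv with ⟨i, rfl⟩ | ⟨i, rfl⟩
  · exact Or.inr ⟨i, rfl⟩
  · exact Or.inl ⟨i, (neg_neg _).symm⟩

lemma coeff_symChar_neg {n : ℕ} (r : ℕ) (β : Fin n → ℚ) :
    (symChar n r).coeff (-β) = (symChar n r).coeff β := by
  conv_lhs => rw [← mapDomain_symChar (negAddMonoidHom : (Fin n → ℚ) →+ _) neg_injective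
    (fun _ hv => neg_mem_signedBasis hv) r]
  exact Finsupp.mapDomain_apply neg_injective _ _

lemma vectorWeight_mem_weightLattice {n : ℕ} (b : Fin n × Bool) :
    vectorWeight b ∈ weightLattice n := by
  unfold vectorWeight
  split_ifs
  · exact neg_mem (eps_mem_weightLattice _)
  · exact eps_mem_weightLattice _

lemma symChar_mem_weightSpan (n r : ℕ) : symChar n r ∈ weightSpan n :=
  sum_mem fun _ _ => expo_mem_weightSpan <| sum_mem fun b _ =>
    natCast_smul_mem_weightLattice _ (vectorWeight_mem_weightLattice b)

/-- The character of the module with highest weight `r ε`: the difference `h_r - h_{r-2}`. -/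
def rowChar (n r : ℕ) : GroupRing n := symChar n r - if 2 ≤ r then symChar n (r - 2) else 0

lemma weylAct_rowChar {n : ℕ} (w : weylGroup n) (r : ℕ) :
    weylAct w (rowChar n r) = rowChar n r := by
  unfold rowChar
  split_ifs <;> simp [weylAct_symChar]

lemma coeff_rowChar_neg {n : ℕ} (r : ℕ) (β : Fin n → ℚ) :
    (rowChar n r).coeff (-β) = (rowChar n r).coeff β := by
  unfold rowChar
  split_ifs <;> simp [coeff_symChar_neg]

lemma rowChar_mem_weightSpan (n r : ℕ) : rowChar n r ∈ weightSpan n := by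
  unfold rowChar
  split_ifs
  · exact sub_mem (symChar_mem_weightSpan n _) (symChar_mem_weightSpan n _)
  · rw [sub_zero]; exact symChar_mem_weightSpan n _

/-- The decomposition of the symmetric powers, `h_R = ∑_{r + 2m = R} s_{r ε}`. -/
lemma symChar_eq_sum_rowChar (n R : ℕ) :
    symChar n R = ∑ m ∈ Finset.range (R / 2 + 1), rowChar n (R - 2 * m) := by
  induction R using Nat.strong_induction_on with
  | _ R ih =>
    rw [Finset.sum_range_succ', mul_zero, Nat.sub_zero]
    by_cases h : 2 ≤ R
    · have h2 : R / 2 = (R - 2) / 2 + 1 := by omega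
      have : ∑ m ∈ Finset.range (R / 2), rowChar n (R - 2 * (m + 1)) = symChar n (R - 2) := by
        rw [ih (R - 2) (by omega), h2]
        exact Finset.sum_congr rfl fun m _ => by congr 1; omega
      rw [this, rowChar, if_pos h, add_sub_cancel]
    · have h2 : R / 2 = 0 := by omega
      rw [h2, Finset.range_zero, Finset.sum_empty, zero_add, rowChar, if_neg h, sub_zero]

lemma mk_rowChar (n : ℕ) :
    PowerSeries.mk (rowChar n) = PowerSeries.mk (symChar n) * (1 - PowerSeries.X ^ 2) := by
  ext r : 1
  rw [mul_sub, mul_one, map_sub, PowerSeries.coeff_mul_X_pow', PowerSeries.coeff_mk,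
    PowerSeries.coeff_mk, PowerSeries.coeff_mk, rowChar]

/-! ### The Weyl character of a one-row weight -/

/-- Alternation over the Weyl group, applied to the coefficients of a power series. -/
def alternateSeries {n : ℕ} : PowerSeries (GroupRing n) →ₗ[ℤ] PowerSeries (GroupRing n) :=
  ∑ w : weylGroup n, weylSign w •
    (PowerSeries.map (weylAct w) : PowerSeries (GroupRing n) →+ _).toIntLinearMap

lemma alternateSeries_apply {n : ℕ} (f : PowerSeries (GroupRing n)) :
    alternateSeries f = ∑ w : weylGroup n, weylSign w • PowerSeries.map (weylAct w) f := by
  simp [alternateSeries]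

lemma coeff_alternateSeries {n : ℕ} (f : PowerSeries (GroupRing n)) (k : ℕ) :
    PowerSeries.coeff k (alternateSeries f) = alternate (PowerSeries.coeff k f) := by
  rw [alternateSeries_apply, alternate_apply, map_sum]
  refine Finset.sum_congr rfl fun w _ => ?_
  rw [map_zsmul, PowerSeries.coeff_map]

lemma alternateSeries_mul_of_invariant {n : ℕ} {g : PowerSeries (GroupRing n)}
    (hg : ∀ w, PowerSeries.map (weylAct w) g = g) (f : PowerSeries (GroupRing n)) :
    alternateSeries (g * f) = g * alternateSeries f := by
  simp only [alternateSeries_apply, Finset.mul_sum, map_mul, hg, mul_smul_comm]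

lemma alternateSeries_C_mul {n : ℕ} (β : Fin n → ℚ) {f : PowerSeries (GroupRing n)}
    (hf : ∀ w, PowerSeries.map (weylAct w) f = f) :
    alternateSeries (PowerSeries.C (expo β) * f) = PowerSeries.C (alt β) * f := by
  rw [mul_comm, alternateSeries_mul_of_invariant hf, mul_comm]
  congr 1
  ext k : 1
  rw [coeff_alternateSeries, PowerSeries.coeff_C, PowerSeries.coeff_C]
  split_ifs
  · exact alternate_expo β
  · exact map_zero _

lemma alternateSeries_eq_zero {n : ℕ} {α : Fin n → ℚ} (hα : α ∈ simpleRoots n)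
    {f : PowerSeries (GroupRing n)} (hf : PowerSeries.map (weylAct (simpleRefl α hα)) f = f) :
    alternateSeries f = 0 := by
  ext k : 1
  have h := alternate_weylAct (simpleRefl α hα) (PowerSeries.coeff k f)
  rw [← PowerSeries.coeff_map, hf, weylSign_simpleRefl, neg_one_zsmul] at h
  rw [coeff_alternateSeries, map_zero]
  exact self_eq_neg.1 h

lemma map_linFactor {n : ℕ} (w : weylGroup n) (v : Fin n → ℚ) :
    PowerSeries.map (weylAct w) (linFactor v) = linFactor (w.1 v) := by
  simp [linFactor]

lemma map_prod_linFactor_vectorWeight {n : ℕ} (w : weylGroup n) :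
    PowerSeries.map (weylAct w) (∏ b : Fin n × Bool, linFactor (vectorWeight b)) =
      ∏ b : Fin n × Bool, linFactor (vectorWeight b) := by
  rw [map_prod]
  simp only [map_linFactor]
  exact prod_vectorWeight_comp linFactor w.1.injective fun v hv => weylGroup_mem w.2 hv

lemma prod_linFactor_vectorWeight (n : ℕ) :
    ∏ b : Fin n × Bool, linFactor (vectorWeight b) =
      (∏ i : Fin n, linFactor (-eps i)) * ∏ i : Fin n, linFactor (eps i) := by
  rw [Fintype.prod_prod_type, ← Finset.prod_mul_distrib]
  exact Finset.prod_congr rfl fun i _ => by simp [vectorWeight]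

lemma prod_neg_C_expo_mul_X {n : ℕ} (S : Finset (Fin n)) (v : Fin n → Fin n → ℚ) :
    ∏ i ∈ S, (-(PowerSeries.C (expo (v i)) * PowerSeries.X) : PowerSeries (GroupRing n)) =
      PowerSeries.C (expo (∑ i ∈ S, v i)) * (-PowerSeries.X) ^ S.card := by
  simp only [← mul_neg]
  rw [Finset.prod_mul_distrib, Finset.prod_const, ← prod_expo, map_prod]

lemma prod_linFactor_eq_sum {n : ℕ} (S : Finset (Fin n)) (v : Fin n → Fin n → ℚ) :
    ∏ i ∈ S, linFactor (v i) =
      ∑ T ∈ S.powerset, PowerSeries.C (expo (∑ i ∈ T, v i)) * (-PowerSeries.X) ^ T.card := by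
  simp only [linFactor, sub_eq_add_neg]
  rw [Finset.prod_one_add]
  exact Finset.sum_congr rfl fun T _ => prod_neg_C_expo_mul_X T v

lemma sum_eps_apply {n : ℕ} (S : Finset (Fin n)) (k : Fin n) :
    (∑ i ∈ S, eps i) k = if k ∈ S then 1 else 0 := by
  rw [Finset.sum_apply]
  simp [eps, Pi.single_apply]

lemma simpleRefl_sub_eps {n : ℕ} {i j : Fin n} (hij : (i : ℕ) + 1 = j) (k : Fin n) :
    (simpleRefl _ (mem_simpleRoots_sub hij)).1 (eps k) = eps (Equiv.swap i j k) := by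
  have hne : i ≠ j := by rintro rfl; omega
  rw [simpleRefl_apply, dot_eps_sub]
  by_cases hi : k = i
  · subst hi; simp [eps, hne]
  · by_cases hj : k = j
    · subst hj; simp [eps, hi]
    · simp [eps, hi, hj, Equiv.swap_apply_of_ne_of_ne, Ne.symm]

/-- If `S` is a nonempty set of positions other than the first, `j` is its least element and
`i = j - 1`, then the vector `ρ + ∑_{k ∈ S} ε_k` and the product over all `-ε_k` are fixed by the
reflection in `ε_i - ε_j`, so that alternation kills the product. -/
lemma alternateSeries_raise_eq_zero {n : ℕ} {S : Finset (Fin n)} (hS : S.Nonempty)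
    (h0 : ∀ i ∈ S, (i : ℕ) ≠ 0) :
    alternateSeries (PowerSeries.C (expo (rho n)) * (∏ i : Fin n, linFactor (-eps i)) *
      (PowerSeries.C (expo (∑ i ∈ S, eps i)) * (-PowerSeries.X) ^ S.card)) = 0 := by
  obtain ⟨j, hj, hmin⟩ := S.exists_min_image id hS
  obtain ⟨i, hij⟩ : ∃ i : Fin n, (i : ℕ) + 1 = j :=
    ⟨⟨j - 1, by have := j.2; omega⟩, by have := h0 j hj; simp only; omega⟩
  have hi : i ∉ S := fun h => by
    have : (j : ℕ) ≤ i := hmin i h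
    omega
  have hP : PowerSeries.map (weylAct (simpleRefl _ (mem_simpleRoots_sub hij)))
      (∏ k : Fin n, linFactor (-eps k)) = ∏ k : Fin n, linFactor (-eps k) := by
    rw [map_prod, ← Equiv.prod_comp (Equiv.swap i j) fun k => linFactor (-eps k)]
    refine Finset.prod_congr rfl fun k _ => ?_
    rw [map_linFactor, map_neg, simpleRefl_sub_eps hij]
  have hv : (simpleRefl _ (mem_simpleRoots_sub hij)).1 (rho n + ∑ i ∈ S, eps i) =
      rho n + ∑ i ∈ S, eps i := by
    have : (rho n + ∑ i ∈ S, eps i) ⬝ᵥ (eps i - eps j) = 0 := by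
      rw [add_dotProduct, rho_dot_simpleRoot (mem_simpleRoots_sub hij), dot_eps_sub,
        sum_eps_apply, sum_eps_apply, if_neg hi, if_pos hj]
      norm_num
    rw [simpleRefl_apply, this, zero_smul, sub_zero]
  refine alternateSeries_eq_zero (mem_simpleRoots_sub hij) ?_
  have hre : PowerSeries.C (expo (rho n)) * (∏ i : Fin n, linFactor (-eps i)) *
      (PowerSeries.C (expo (∑ i ∈ S, eps i)) * (-PowerSeries.X) ^ S.card) =
      PowerSeries.C (expo (rho n + ∑ i ∈ S, eps i)) * (∏ i : Fin n, linFactor (-eps i)) *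
        (-PowerSeries.X) ^ S.card := by
    rw [← expo_mul, map_mul]; ring
  rw [hre, map_mul, map_mul, hP, PowerSeries.map_C, weylAct_single, hv, map_pow, map_neg,
    PowerSeries.map_X]

lemma rho_sub_dot_simpleRoot {n : ℕ} {α : Fin n → ℚ} (hα : α ∈ simpleRoots n)
    (T : Finset (Fin n)) :
    (rho n - ∑ i ∈ T, eps i) ⬝ᵥ α = 1 - (∑ i ∈ T, eps i) ⬝ᵥ α := by
  rw [sub_dotProduct, rho_dot_simpleRoot hα]

/-- The alternating sums `a_{ρ - ∑_{k ∈ T} ε_k}`.  Unless `T` is empty or consists of the last two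
positions `a` and `b`, the vector is fixed by a reflection. -/
lemma alt_rho_sub {n : ℕ} {a b : Fin n} (hab : (a : ℕ) + 1 = b) (hb : (b : ℕ) + 1 = n)
    (T : Finset (Fin n)) :
    alt (rho n - ∑ i ∈ T, eps i) =
      if T = ∅ then alt (rho n) else if T = {a, b} then -alt (rho n) else 0 := by
  have hne : a ≠ b := by rintro rfl; omega
  by_cases h1 : ∃ i j : Fin n, (i : ℕ) + 1 = j ∧ i ∈ T ∧ j ∉ T
  · obtain ⟨i, j, hij, hi, hj⟩ := h1
    have hT : T ≠ ∅ := by rintro rfl; simp at hi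
    have hT2 : T ≠ {a, b} := by
      rintro rfl
      simp only [Finset.mem_insert, Finset.mem_singleton, not_or] at hi hj
      rcases hi with rfl | rfl
      · exact hj.2 (Fin.ext (by omega))
      · have := j.2; omega
    rw [if_neg hT, if_neg hT2]
    apply alt_eq_zero (mem_simpleRoots_sub hij)
    rw [rho_sub_dot_simpleRoot (mem_simpleRoots_sub hij), dot_eps_sub, sum_eps_apply,
      sum_eps_apply, if_pos hi, if_neg hj]
    norm_num
  · push Not at h1
    -- In the remaining case `T` is closed under passing to later positions.
    have hup : ∀ d : ℕ, ∀ i j : Fin n, (i : ℕ) + d = j → i ∈ T → j ∈ T := by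
      intro d
      induction d with
      | zero => intro i j hij hi; rwa [← (Fin.ext hij : i = j)]
      | succ d ih =>
        intro i j hij hi
        have := j.2
        exact h1 ⟨j - 1, by omega⟩ j (by simp only; omega)
          (ih i ⟨j - 1, by omega⟩ (by simp only; omega) hi)
    by_cases hbT : b ∈ T
    · have hT : T ≠ ∅ := by rintro rfl; simp at hbT
      rw [if_neg hT]
      by_cases haT : a ∈ T
      · have hdot : (rho n - ∑ i ∈ T, eps i) ⬝ᵥ (eps a + eps b) = -1 := by
          rw [rho_sub_dot_simpleRoot (mem_simpleRoots_add hab hb), dot_eps_add, sum_eps_apply,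
            sum_eps_apply, if_pos haT, if_pos hbT]
          norm_num
        have hrefl := alt_simpleRefl (mem_simpleRoots_add hab hb) (rho n - ∑ i ∈ T, eps i)
        rw [hdot, neg_smul, one_smul, sub_neg_eq_add] at hrefl
        by_cases hT2 : T = {a, b}
        · rw [if_pos hT2]
          rw [hT2, Finset.sum_pair hne, sub_add_cancel] at hrefl
          rw [hT2, Finset.sum_pair hne, hrefl, neg_neg]
        · rw [if_neg hT2]
          -- Here `T` ends in three consecutive positions `c`, `a`, `b`.  The reflection in
          -- `ε_a + ε_b` leads to a vector that is orthogonal to `ε_c - ε_a`.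
          obtain ⟨c, hca, hc⟩ : ∃ c : Fin n, (c : ℕ) + 1 = a ∧ c ∈ T := by
            obtain ⟨i, hi, hi2⟩ : ∃ i ∈ T, i ∉ ({a, b} : Finset (Fin n)) := by
              by_contra! hcon
              refine hT2 (Finset.Subset.antisymm hcon ?_)
              rintro x hx
              simp only [Finset.mem_insert, Finset.mem_singleton] at hx
              rcases hx with rfl | rfl <;> assumption
            simp only [Finset.mem_insert, Finset.mem_singleton, not_or, Fin.ext_iff] at hi2
            have := i.2
            exact ⟨⟨a - 1, by omega⟩, by simp only; omega,
              hup (a - 1 - i) i _ (by simp only; omega) hi⟩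
          have hzero : alt (rho n - ∑ i ∈ T, eps i + (eps a + eps b)) = 0 := by
            apply alt_eq_zero (mem_simpleRoots_sub hca)
            have hca' : c ≠ a := by rintro rfl; omega
            have hcb' : c ≠ b := by rintro rfl; omega
            rw [add_dotProduct, rho_sub_dot_simpleRoot (mem_simpleRoots_sub hca), dot_eps_sub,
              dot_eps_sub, sum_eps_apply, sum_eps_apply, if_pos hc, if_pos haT]
            simp [eps, hca', hcb', hne]
          rw [hzero] at hrefl
          exact neg_eq_zero.1 hrefl.symm
      · have hT2 : T ≠ {a, b} := by rintro rfl; simp at haT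
        rw [if_neg hT2]
        apply alt_eq_zero (mem_simpleRoots_add hab hb)
        rw [rho_sub_dot_simpleRoot (mem_simpleRoots_add hab hb), dot_eps_add, sum_eps_apply,
          sum_eps_apply, if_neg haT, if_pos hbT]
        norm_num
    · have hT : T = ∅ := Finset.eq_empty_of_forall_notMem fun i hi => hbT
        (hup (b - i) i b (by have := i.2; omega) hi)
      rw [if_pos hT, hT, Finset.sum_empty, sub_zero]

/-- `∑_w (-1)^{ℓ(w)} w(x^ρ ∏_i (1 - q x^{-ε_i})) = (1 - q²) a_ρ`: in the expansion of the product only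
the empty set of positions and the set of the last two positions contribute. -/
lemma alternateSeries_rho_mul_prod {n : ℕ} (hn : 2 ≤ n) :
    alternateSeries (PowerSeries.C (expo (rho n)) * ∏ i : Fin n, linFactor (-eps i)) =
      PowerSeries.C (alt (rho n)) * (1 - PowerSeries.X ^ 2) := by
  have hterm : ∀ T : Finset (Fin n), alternateSeries (PowerSeries.C (expo (rho n)) *
      (PowerSeries.C (expo (∑ i ∈ T, -eps i)) * (-PowerSeries.X) ^ T.card)) =
      PowerSeries.C (alt (rho n - ∑ i ∈ T, eps i)) * (-PowerSeries.X) ^ T.card := fun T => by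
    rw [← mul_assoc, ← map_mul, expo_mul, Finset.sum_neg_distrib, ← sub_eq_add_neg]
    exact alternateSeries_C_mul _ fun w => by rw [map_pow, map_neg, PowerSeries.map_X]
  obtain ⟨a, b, hab, hb⟩ : ∃ a b : Fin n, (a : ℕ) + 1 = b ∧ (b : ℕ) + 1 = n :=
    ⟨⟨n - 2, by omega⟩, ⟨n - 1, by omega⟩, by simp only; omega, by simp only; omega⟩
  have hne : a ≠ b := by rintro rfl; omega
  rw [prod_linFactor_eq_sum, Finset.mul_sum, map_sum]
  simp only [hterm]
  rw [Finset.sum_eq_add (∅ : Finset (Fin n)) {a, b} (Finset.insert_ne_empty a {b}).symm]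
  · rw [alt_rho_sub hab hb, alt_rho_sub hab hb, if_pos rfl, if_neg (Finset.insert_ne_empty _ _),
      if_pos rfl, Finset.card_empty, Finset.card_pair hne, map_neg]
    ring
  · intro T _ hT
    rw [alt_rho_sub hab hb, if_neg hT.1, if_neg hT.2, map_zero, zero_mul]
  · simp
  · simp

/-- The Weyl character formula for the highest weight `r ε`: `(h_r - h_{r-2}) a_ρ = a_{r ε + ρ}`.
Multiplied by the invariant `∏ (1 - q x^{±ε_i})`, the generating function of the right-hand side
becomes the alternation of `x^ρ ∏_i (1 - q x^{-ε_i}) ∏_{i > 1} (1 - q x^{ε_i})`; the last product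
does not contribute, and what is left is `(1 - q²) a_ρ`. -/
lemma rowChar_mul_alt_rho {n : ℕ} (hn : 2 ≤ n) (r : ℕ) :
    rowChar n r * alt (rho n) = alt (rowWeight n r + rho n) := by
  obtain ⟨z, hz⟩ : ∃ z : Fin n, (z : ℕ) = 0 := ⟨⟨0, by omega⟩, rfl⟩
  set E : PowerSeries (GroupRing n) := ∏ b : Fin n × Bool, linFactor (vectorWeight b) with hE
  set P : PowerSeries (GroupRing n) := ∏ i : Fin n, linFactor (-eps i) with hP
  have hrow : ∀ r : ℕ, rowWeight n r = (r : ℚ) • eps z := fun r => by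
    ext i
    have : (i : ℕ) = 0 ↔ i = z := by rw [Fin.ext_iff, hz]
    simp [rowWeight, eps, Pi.single_apply, this]
  have hF : PowerSeries.mk (fun r => alt (rowWeight n r + rho n)) =
      alternateSeries (PowerSeries.C (expo (rho n)) * geom (eps z)) := by
    ext r : 1
    rw [coeff_alternateSeries, PowerSeries.coeff_C_mul, geom, PowerSeries.coeff_mk,
      PowerSeries.coeff_mk, expo_mul, alternate_expo, hrow, add_comm]
  have hEH : E * PowerSeries.mk (symChar n) = 1 := by
    have : PowerSeries.mk (symChar n) = ∏ b : Fin n × Bool, geom (vectorWeight b) := mk_complete _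
    rw [this, hE, ← Finset.prod_mul_distrib]
    exact Finset.prod_eq_one fun b _ => linFactor_mul_geom _
  have hEgeom : E * (PowerSeries.C (expo (rho n)) * geom (eps z)) =
      PowerSeries.C (expo (rho n)) * P * ∏ i ∈ Finset.univ.erase z, linFactor (eps i) := by
    rw [hE, prod_linFactor_vectorWeight,
      ← Finset.mul_prod_erase _ (fun i => linFactor (eps i)) (Finset.mem_univ z)]
    linear_combination (PowerSeries.C (expo (rho n)) * P *
      ∏ i ∈ Finset.univ.erase z, linFactor (eps i)) * linFactor_mul_geom (eps z)
  have hEF : E * PowerSeries.mk (fun r => alt (rowWeight n r + rho n)) =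
      PowerSeries.C (alt (rho n)) * (1 - PowerSeries.X ^ 2) := by
    rw [hF, ← alternateSeries_mul_of_invariant map_prod_linFactor_vectorWeight, hEgeom,
      prod_linFactor_eq_sum, Finset.mul_sum, map_sum, Finset.sum_eq_single ∅]
    · rw [← prod_expo, Finset.prod_empty, Finset.card_empty, pow_zero, mul_one, map_one, mul_one,
        alternateSeries_rho_mul_prod hn]
    · intro S hS hne
      refine alternateSeries_raise_eq_zero (Finset.nonempty_iff_ne_empty.2 hne) fun i hi h => ?_
      have := Finset.mem_powerset.1 hS hi
      exact (Finset.mem_erase.1 this).1 (Fin.ext (by rw [h, hz]))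
    · simp
  have hmain : PowerSeries.mk (rowChar n) * PowerSeries.C (alt (rho n)) =
      PowerSeries.mk (fun r => alt (rowWeight n r + rho n)) := by
    rw [mk_rowChar]
    linear_combination (PowerSeries.mk (fun r => alt (rowWeight n r + rho n))) * hEH -
      PowerSeries.mk (symChar n) * hEF
  have := congrArg (PowerSeries.coeff r) hmain
  rwa [PowerSeries.coeff_mul_C, PowerSeries.coeff_mk, PowerSeries.coeff_mk] at this

/-- Brauer's formula for the Pieri multiplicities. -/
lemma pieriMult_eq {n : ℕ} (hn : 2 ≤ n) (γ lam : Dom n) (r : ℕ) :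
    pieriMult γ r lam = domCoeff lam (rowChar n r * expo γ.1) :=
  tensorMult_eq hn (fun w => weylAct_rowChar w r) (rowChar_mul_alt_rho hn r)
    (rowChar_mem_weightSpan n r) γ lam

/-- The symmetry of the Pieri multiplicities, due to the self-duality of `V(r ε)`. -/
lemma pieriMult_symm {n : ℕ} (hn : 2 ≤ n) (γ lam : Dom n) (r : ℕ) :
    pieriMult γ r lam = pieriMult lam r γ := by
  rw [pieriMult_eq hn, pieriMult_eq hn,
    domCoeff_mul_symm (fun w => weylAct_rowChar w r) (coeff_rowChar_neg r)]

/-! ### Kostka–Foulkes polynomials as straightening coefficients -/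

/-- The coefficient of `q^M` in `x^β ∏_{α > 0} (1 - q x^α)⁻¹`. -/
def raised {n : ℕ} (β : Fin n → ℚ) (M : ℕ) : GroupRing n :=
  expo β * complete (PosRoot.vec (n := n)) M

lemma coeff_partitionFn {n : ℕ} (β : Fin n → ℚ) (M : ℕ) :
    (partitionFn β).coeff M = (complete (PosRoot.vec (n := n)) M).coeff β := by
  classical
  rw [partitionFn, Polynomial.finsetSum_coeff, complete, AddMonoidAlgebra.coeff_sum,
    Finsupp.finsetSum_apply]
  simp only [Polynomial.coeff_X_pow, AddMonoidAlgebra.coeff_single, Finsupp.single_apply]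
  rw [← Finset.sum_filter, ← Finset.sum_filter]
  refine Finset.sum_congr ?_ fun _ _ => rfl
  ext k
  simp only [Finset.mem_filter, Set.Finite.mem_toFinset, Set.mem_ofPred_eq, Finset.mem_piAntidiag,
    Finset.mem_univ, implies_true, and_true]
  rw [and_comm, eq_comm]

/-- The coefficients of the Kostka–Foulkes polynomials are straightening coefficients. -/
lemma coeff_kostkaFoulkes {n : ℕ} (lam : Dom n) (mu : Fin n → ℚ) (M : ℕ) :
    (kostkaFoulkes lam.1 mu).coeff M = domCoeff lam (raised mu M) := by
  rw [kostkaFoulkes, Polynomial.finsetSum_coeff, domCoeff_apply]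
  refine Finset.sum_congr rfl fun w _ => ?_
  have hC : ((-1) ^ length w : Polynomial ℤ) = Polynomial.C (weylSign w) := by simp [weylSign]
  rw [hC, Polynomial.coeff_C_mul, coeff_partitionFn, raised,
    AddMonoidAlgebra.coeff_single_mul_apply, one_mul]
  congr 2
  abel

lemma raised_mem_weightSpan {n : ℕ} {β : Fin n → ℚ} (hβ : β ∈ weightLattice n) (M : ℕ) :
    raised β M ∈ weightSpan n := by
  rw [raised, mul_comm]
  refine mul_expo_mem_weightSpan
    (sum_mem fun _ _ => expo_mem_weightSpan <| sum_mem fun α _ => ?_) hβ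
  exact natCast_smul_mem_weightLattice _ (posRoot_mem_weightLattice α)

/-! ### Splitting off the positive roots that involve the first coordinate -/

lemma prod_posRoot {n : ℕ} {M : Type*} [CommMonoid M] (G : (Fin n → ℚ) → M) :
    ∏ α : PosRoot n, G α.vec =
      ∏ i : Fin n, ∏ j : Fin n, if i < j then G (eps i - eps j) * G (eps i + eps j) else 1 := by
  rw [Fintype.prod_prod_type]
  simp only [Fintype.prod_bool, PosRoot.vec, if_true, Bool.false_eq_true, if_false]
  rw [← Finset.prod_subtype (Finset.univ.filter fun p : Fin n × Fin n => p.1 < p.2) (by simp)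
    (fun p : Fin n × Fin n => G (eps p.1 - eps p.2) * G (eps p.1 + eps p.2)), Finset.prod_filter,
    Fintype.prod_prod_type]

lemma eps_zero_eq_cons (n : ℕ) : eps (0 : Fin (n + 1)) = (Fin.cons 1 0 : Fin (n + 1) → ℚ) := by
  ext k
  refine Fin.cases ?_ (fun k => ?_) k <;> simp [eps]

lemma cons_sub_cons {n : ℕ} (a b : ℚ) (v w : Fin n → ℚ) :
    (Fin.cons a v - Fin.cons b w : Fin (n + 1) → ℚ) = Fin.cons (a - b) (v - w) := by
  ext k
  refine Fin.cases ?_ (fun k => ?_) k <;> simp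

/-- The positive roots of `D_{n+1}` are the vectors `(1, ± ε_i)` and the vectors `(0, α)` with `α` a
positive root of `D_n`. -/
lemma prod_posRoot_succ {n : ℕ} {M : Type*} [CommMonoid M] (G : (Fin (n + 1) → ℚ) → M) :
    ∏ α : PosRoot (n + 1), G α.vec =
      (∏ b : Fin n × Bool, G (Fin.cons 1 (vectorWeight b))) *
        ∏ α : PosRoot n, G (Fin.cons 0 α.vec) := by
  rw [prod_posRoot, prod_posRoot fun v => G (Fin.cons 0 v), Fin.prod_univ_succ,
    Fin.prod_univ_succ, Fintype.prod_prod_type]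
  simp only [Fin.prod_univ_succ (n := n), lt_irrefl, if_false, one_mul, Fin.succ_pos, if_true,
    Fin.not_lt_zero, Fin.succ_lt_succ_iff, ← cons_zero_eps, eps_zero_eq_cons, cons_sub_cons,
    cons_add_cons, sub_zero, add_zero, zero_sub, zero_add, Fintype.prod_bool, vectorWeight,
    Bool.false_eq_true]

lemma complete_posRoot_succ (n N : ℕ) :
    complete (PosRoot.vec (n := n + 1)) N = ∑ p ∈ Finset.HasAntidiagonal.antidiagonal N,
      complete (fun b : Fin n × Bool => (Fin.cons 1 (vectorWeight b) : Fin (n + 1) → ℚ)) p.1 *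
        complete (fun α : PosRoot n => (Fin.cons 0 α.vec : Fin (n + 1) → ℚ)) p.2 := by
  have h := congrArg (PowerSeries.coeff N) (mk_complete (PosRoot.vec (n := n + 1)))
  rw [prod_posRoot_succ geom,
    ← mk_complete fun b : Fin n × Bool => (Fin.cons 1 (vectorWeight b) : Fin (n + 1) → ℚ),
    ← mk_complete fun α : PosRoot n => (Fin.cons 0 α.vec : Fin (n + 1) → ℚ),
    PowerSeries.coeff_mul, PowerSeries.coeff_mk] at h
  simpa only [PowerSeries.coeff_mk] using h

lemma complete_mul_complete {n : ℕ} {ι κ : Type*} [Fintype ι] [DecidableEq ι] [Fintype κ]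
    [DecidableEq κ] (u : ι → Fin n → ℚ) (v : κ → Fin n → ℚ) (R M : ℕ) :
    complete u R * complete v M = ∑ c ∈ Finset.piAntidiag Finset.univ R,
      ∑ k ∈ Finset.piAntidiag Finset.univ M,
        expo (∑ b, (c b : ℚ) • u b + ∑ α, (k α : ℚ) • v α) := by
  rw [complete, complete, Finset.sum_mul_sum]
  exact Finset.sum_congr rfl fun c _ => Finset.sum_congr rfl fun k _ => expo_mul _ _

lemma linExt_expo_mul {n : ℕ} {V : Type*} [AddCommGroup V] (φ : (Fin n → ℚ) → V)
    (β : Fin n → ℚ) (f : GroupRing n) :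
    linExt φ (expo β * f) = linExt (fun x => φ (β + x)) f := by
  induction f using AddMonoidAlgebra.induction_linear with
  | zero => simp
  | add f g hf hg => rw [mul_add, map_add, map_add, hf, hg]
  | single γ c =>
    have hc : (AddMonoidAlgebra.single γ c : GroupRing n) = c • expo γ := by simp
    rw [hc, mul_smul_comm, map_zsmul, map_zsmul, expo_mul, linExt_expo, linExt_expo]

lemma linExt_complete_mul_complete {n : ℕ} {V : Type*} [AddCommGroup V] (φ : (Fin n → ℚ) → V)
    {ι κ : Type*} [Fintype ι] [DecidableEq ι] [Fintype κ]
    [DecidableEq κ] (u : ι → Fin n → ℚ) (v : κ → Fin n → ℚ) (R M : ℕ) :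
    linExt φ (complete u R * complete v M) = ∑ c ∈ Finset.piAntidiag Finset.univ R,
      ∑ k ∈ Finset.piAntidiag Finset.univ M,
        φ (∑ b, (c b : ℚ) • u b + ∑ α, (k α : ℚ) • v α) := by
  rw [complete_mul_complete, map_sum]
  refine Finset.sum_congr rfl fun c _ => ?_
  rw [map_sum]
  exact Finset.sum_congr rfl fun k _ => linExt_expo _ _

lemma linExt_complete {n : ℕ} {V : Type*} [AddCommGroup V] (φ : (Fin n → ℚ) → V)
    {ι : Type*} [Fintype ι] [DecidableEq ι] (u : ι → Fin n → ℚ) (N : ℕ) :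
    linExt φ (complete u N) = ∑ c ∈ Finset.piAntidiag Finset.univ N,
      φ (∑ b, (c b : ℚ) • u b) := by
  rw [complete, map_sum]
  exact Finset.sum_congr rfl fun c _ => linExt_expo _ _

lemma coeff_hallLittlewoodQ_eq_linExt {n : ℕ} (mu : Fin n → ℚ) (N : ℕ) :
    PowerSeries.coeff N (hallLittlewoodQ mu) =
      linExt (fun β => schur (mu + β)) (complete (PosRoot.vec (n := n)) N) := by
  rw [hallLittlewoodQ, PowerSeries.coeff_mk, linExt_complete]

/-- The coefficients of `Q_μ` in rank `n + 1` as values of functionals on the group ring of rank `n`: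
the roots `(1, ±ε_i)` contribute the symmetric powers and raise the first coordinate by `R`. -/
lemma coeff_hallLittlewoodQ {n : ℕ} (mu : Fin (n + 1) → ℚ) (N : ℕ) :
    PowerSeries.coeff N (hallLittlewoodQ mu) = ∑ p ∈ Finset.HasAntidiagonal.antidiagonal N,
      schurCons (mu 0 + p.1) (symChar n p.1 * raised (Fin.tail mu) p.2) := by
  rw [coeff_hallLittlewoodQ_eq_linExt, complete_posRoot_succ, map_sum]
  refine Finset.sum_congr rfl fun p _ => ?_
  rw [symChar, raised, mul_left_comm, schurCons, linExt_expo_mul, linExt_complete_mul_complete,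
    linExt_complete_mul_complete]
  refine Finset.sum_congr rfl fun c hc => Finset.sum_congr rfl fun k _ => ?_
  congr 1
  have hcR : (∑ b, (c b : ℚ)) = p.1 := by
    rw [← (Finset.mem_piAntidiag.1 hc).1]; push_cast; rfl
  ext i
  refine Fin.cases ?_ (fun i => ?_) i
  · simp [hcR]
  · simp [Fin.tail]

/-! ### The expansion of `Q_μ` -/

lemma schurCons_symChar_mul_raised {n : ℕ} (hn : 2 ≤ n) {β : Fin n → ℚ}
    (hβ : β ∈ weightLattice n) (a : ℚ) (R M : ℕ) :
    schurCons a (symChar n R * raised β M) =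
      (straighten (raised β M)).sum fun lam c =>
        (c : CharField (n + 1)) * schurCons a (symChar n R * expo lam.1) :=
  (((isDotAntisymmetric_schurCons a).mul_invariant
    (fun w => weylAct_symChar w R)).apply_eq_straighten hn (raised_mem_weightSpan hβ M)).trans
    (Finset.sum_congr rfl fun _ _ => zsmul_eq_mul _ _)

lemma schurCons_rowChar_mul_expo {n : ℕ} (hn : 2 ≤ n) (a : ℚ) (r : ℕ) (lam : Dom n) :
    schurCons a (rowChar n r * expo lam.1) =
      (straighten (rowChar n r * expo lam.1)).sum fun γ d =>
        (d : CharField (n + 1)) * schur (Fin.cons a γ.1 : Fin (n + 1) → ℚ) :=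
  ((isDotAntisymmetric_schurCons a).apply_eq_straighten hn
    (mul_expo_mem_weightSpan (rowChar_mem_weightSpan n r) lam.2.mem_weightLattice)).trans
    (Finset.sum_congr rfl fun _ _ => (zsmul_eq_mul _ _).trans (by rw [schurCons, linExt_expo]))

lemma straighten_rowChar {n : ℕ} (hn : 2 ≤ n) (r : ℕ) (lam γ : Dom n) :
    straighten (rowChar n r * expo lam.1) γ = pieriMult γ r lam := by
  rw [pieriMult_symm hn, pieriMult_eq hn, straighten_apply]

/-- The contribution of `r`, `γ` and `λ` to the coefficient of `q^{R + M}`. -/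
def contribution {n : ℕ} (mu : Fin (n + 1) → ℚ) (R M r : ℕ) (p : Dom n × Dom n) :
    CharField (n + 1) :=
  ((kostkaFoulkes p.2.1 (Fin.tail mu)).coeff M : CharField (n + 1)) *
    ((pieriMult p.1 r p.2 : CharField (n + 1)) *
      schur (Fin.cons (mu 0 + R) p.1.1 : Fin (n + 1) → ℚ))

lemma schurCons_eq_sum_contribution {n : ℕ} (hn : 2 ≤ n) {mu : Fin (n + 1) → ℚ}
    (hmu : Fin.tail mu ∈ weightLattice n) (R M : ℕ) {Γ Λ : Finset (Dom n)}
    (hΛ : (straighten (raised (Fin.tail mu) M)).support ⊆ Λ)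
    (hΓ : ∀ r ≤ R, ∀ lam ∈ Λ, (straighten (rowChar n r * expo lam.1)).support ⊆ Γ) :
    schurCons (mu 0 + R) (symChar n R * raised (Fin.tail mu) M) =
      ∑ m ∈ Finset.range (R / 2 + 1), ∑ p ∈ Γ ×ˢ Λ, contribution mu R M (R - 2 * m) p := by
  rw [schurCons_symChar_mul_raised hn hmu, Finsupp.sum_of_support_subset _ hΛ _ (by simp)]
  simp only [Finset.sum_product_right]
  rw [Finset.sum_comm]
  refine Finset.sum_congr rfl fun lam hlam => ?_
  rw [symChar_eq_sum_rowChar, Finset.sum_mul, map_sum, Finset.mul_sum]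
  refine Finset.sum_congr rfl fun m _ => ?_
  rw [schurCons_rowChar_mul_expo hn,
    Finsupp.sum_of_support_subset _ (hΓ _ (Nat.sub_le _ _) lam hlam) _ (by simp), Finset.mul_sum]
  refine Finset.sum_congr rfl fun γ _ => ?_
  rw [straighten_rowChar hn, straighten_apply, ← coeff_kostkaFoulkes, contribution]

/-- The coefficient of `q^N` in the summand of the recurrence, as a function of `(r, m)` and
`(γ, λ)`. -/
def termCoeff {n : ℕ} (mu : Fin (n + 1) → ℚ) (N : ℕ) (t : (ℕ × ℕ) × (Dom n × Dom n)) :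
    CharField (n + 1) :=
  if t.1.1 + 2 * t.1.2 ≤ N then
    contribution mu (t.1.1 + 2 * t.1.2) (N - (t.1.1 + 2 * t.1.2)) t.1.1 t.2 else 0

/-- The free parameters of an index of the recurrence. -/
def MorrisIndex.params {n : ℕ} (i : MorrisIndex n) : (ℕ × ℕ) × (Dom n × Dom n) :=
  ((i.r, i.m), (i.gam, i.lam))

lemma MorrisIndex.params_injective {n : ℕ} :
    Function.Injective (MorrisIndex.params (n := n)) := by
  rintro ⟨γ, R, r, m, rfl, lam, h⟩ ⟨γ', R', r', m', rfl, lam', h'⟩ heq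
  simp only [MorrisIndex.params, Prod.mk.injEq] at heq
  obtain ⟨⟨rfl, rfl⟩, rfl, rfl⟩ := heq
  rfl

lemma coeff_morrisTerm {n : ℕ} (mu : Fin (n + 1) → ℚ) (N : ℕ) (i : MorrisIndex n) :
    PowerSeries.coeff N (morrisTerm mu i) = termCoeff mu N i.params := by
  obtain ⟨γ, R, r, m, rfl, lam, h⟩ := i
  change _ = if r + 2 * m ≤ N then
    contribution mu (r + 2 * m) (N - (r + 2 * m)) r (γ, lam) else 0
  rw [morrisTerm, PowerSeries.coeff_mul_C, PowerSeries.coeff_X_pow_mul', Polynomial.coeff_coe,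
    Polynomial.coeff_map]
  split_ifs
  · rfl
  · rw [zero_mul]

/-- Summation over `m ≤ R / 2` for all `R ≤ N`, rewritten with the variables `r = R - 2m` and `m`. -/
lemma sum_range_div_two {V : Type*} [AddCommMonoid V] (T : ℕ → ℕ → V) (N : ℕ) :
    ∑ R ∈ Finset.range (N + 1), ∑ m ∈ Finset.range (R / 2 + 1), T R (R - 2 * m) =
      ∑ p ∈ Finset.range (N + 1) ×ˢ Finset.range (N + 1),
        if p.1 + 2 * p.2 ≤ N then T (p.1 + 2 * p.2) p.1 else 0 := by
  rw [← Finset.sum_filter, Finset.sum_sigma']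
  refine Finset.sum_bij' (fun s _ => (s.1 - 2 * s.2, s.2))
    (fun p _ => ⟨p.1 + 2 * p.2, p.2⟩) ?_ ?_ ?_ ?_ ?_
  · rintro ⟨R, m⟩ h
    simp only [Finset.mem_sigma, Finset.mem_range, Finset.mem_filter, Finset.mem_product] at h ⊢
    omega
  · rintro ⟨r, m⟩ h
    simp only [Finset.mem_sigma, Finset.mem_range, Finset.mem_filter, Finset.mem_product] at h ⊢
    omega
  · rintro ⟨R, m⟩ h
    simp only [Finset.mem_sigma, Finset.mem_range] at h
    simp only [Sigma.mk.injEq, heq_eq_eq, and_true]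
    omega
  · rintro ⟨r, m⟩ h
    simp
  · rintro ⟨R, m⟩ h
    simp only [Finset.mem_sigma, Finset.mem_range] at h
    have : R - 2 * m + 2 * m = R := by omega
    simp only [this]

theorem hasFormalSum_morrisTerm {n : ℕ} (hn : 2 ≤ n) {mu : Fin (n + 1) → ℚ}
    (hmu : IsDominant mu) : HasFormalSum (morrisTerm mu) (hallLittlewoodQ mu) := by
  classical
  intro N
  have hmu' : Fin.tail mu ∈ weightLattice n := fun α hα => by
    rw [← dotProduct_cons_zero]
    exact hmu.mem_weightLattice _ (cons_zero_mem_simpleRoots hα)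
  -- Finite sets of weights `λ` and `γ` outside of which nothing contributes to `q^N`.
  set Λ : Finset (Dom n) := (Finset.range (N + 1)).biUnion fun M =>
    (straighten (raised (Fin.tail mu) M)).support with hΛ
  set Γ : Finset (Dom n) := (Finset.range (N + 1)).biUnion fun r => Λ.biUnion fun lam =>
    (straighten (rowChar n r * expo lam.1)).support with hΓ
  set S : Finset ((ℕ × ℕ) × (Dom n × Dom n)) :=
    (Finset.range (N + 1) ×ˢ Finset.range (N + 1)) ×ˢ (Γ ×ˢ Λ) with hS
  have hsupp : ∀ t, termCoeff mu N t ≠ 0 → t ∈ S ∧ t ∈ Set.range (MorrisIndex.params (n := n)) := by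
    rintro ⟨⟨r, m⟩, γ, lam⟩ ht
    rw [termCoeff] at ht
    split_ifs at ht with hN
    · simp only at hN
      rw [contribution] at ht
      have hK : (kostkaFoulkes lam.1 (Fin.tail mu)).coeff (N - (r + 2 * m)) ≠ 0 := fun h =>
        ht (by simp only [h, Int.cast_zero, zero_mul])
      have hd : pieriMult γ r lam ≠ 0 := fun h =>
        ht (by simp only [h, Int.cast_zero, zero_mul, mul_zero])
      have hlam : lam ∈ Λ := Finset.mem_biUnion.2 ⟨N - (r + 2 * m),
        Finset.mem_range.2 (by omega), by
        rwa [Finsupp.mem_support_iff, straighten_apply, ← coeff_kostkaFoulkes]⟩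
      have hγ : γ ∈ Γ := Finset.mem_biUnion.2 ⟨r, Finset.mem_range.2 (by omega),
        Finset.mem_biUnion.2 ⟨lam, hlam, by
        rwa [Finsupp.mem_support_iff, straighten_rowChar hn]⟩⟩
      refine ⟨?_, ⟨γ, r + 2 * m, r, m, rfl, lam, hd⟩, rfl⟩
      simp only [hS, Finset.mem_product, Finset.mem_range]
      exact ⟨⟨by omega, by omega⟩, hγ, hlam⟩
    · exact absurd rfl ht
  simp only [coeff_morrisTerm]
  constructor
  · exact (S.finite_toSet.preimage MorrisIndex.params_injective.injOn).subset
      fun i hi => (hsupp _ hi).1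
  · rw [← finsum_mem_range MorrisIndex.params_injective,
      finsum_mem_eq_sum_of_inter_support_eq (termCoeff mu N) (t := S), hS, Finset.sum_product,
      coeff_hallLittlewoodQ, Finset.Nat.sum_antidiagonal_eq_sum_range_succ_mk]
    · have hR : ∀ R ∈ Finset.range N.succ,
          schurCons (mu 0 + R) (symChar n R * raised (Fin.tail mu) (N - R)) =
          ∑ m ∈ Finset.range (R / 2 + 1), ∑ p ∈ Γ ×ˢ Λ,
            contribution mu R (N - R) (R - 2 * m) p := by
        intro R hR
        rw [Finset.mem_range] at hR
        refine schurCons_eq_sum_contribution hn hmu' R (N - R) ?_ fun r hr lam hlam => ?_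
        · exact Finset.subset_biUnion_of_mem
            (fun M => (straighten (raised (Fin.tail mu) M)).support)
            (Finset.mem_range.2 (by omega))
        · intro γ hγ
          exact Finset.mem_biUnion.2 ⟨r, Finset.mem_range.2 (by omega),
            Finset.mem_biUnion.2 ⟨lam, hlam, hγ⟩⟩
      rw [Finset.sum_congr rfl hR,
        sum_range_div_two fun R r => ∑ p ∈ Γ ×ˢ Λ, contribution mu R (N - R) r p]
      refine Finset.sum_congr rfl fun p _ => ?_
      simp only [termCoeff]
      split_ifs
      · rfl
      · exact Finset.sum_const_zero
    · ext t
      simp only [Set.mem_inter_iff, Function.mem_support, Finset.mem_coe]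
      exact ⟨fun h => ⟨(hsupp t h.2).1, h.2⟩, fun h => ⟨(hsupp t h.2).2, h.2⟩⟩

end

end TypeD

theorem theorem3p2 (n : ℕ) (hn : 2 ≤ n) (mu : Fin (n + 1) → ℚ) (hmu : TypeD.IsDominant mu) :
    TypeD.HasFormalSum (TypeD.morrisTerm mu) (TypeD.hallLittlewoodQ mu) :=
  TypeD.hasFormalSum_morrisTerm hn hmu
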